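/- For $n\in\mathbb{N}$ and $r\in[1,\infty]$ let $\mathbb{S}_r^n=\{x\in\mathbb{R}^n:\|x\|_r=1\}$. For $p,q\in[1,\infty]$ with $\frac1p+\frac1q=1$, a finite set $H\subseteq\mathbb{S}_p^n$ is a $\tau$-hitting set of $\mathbb{S}_p^n$ ($\tau\ge 0$) if for every $x\in\mathbb{S}_q^n$ there is $v\in H$ with $x^{\mathrm T}v\ge\tau$; let $\mathbb{T}_p^n(\tau,m)$ be the family of all $\tau$-hitting sets of $\mathbb{S}_p^n$ with at most $m$ elements. For $p\in(2,\infty)$, a random vector is called even on $\mathbb{S}_p^n$ if it is distributed as $y/\|y\|_p$, where the entries of $y\in\mathbb{R}^n$ are i.i.d. with density $p\,e^{-|x|^p}\big/\int_0^\infty 2t^{\frac{1-p}{p}}e^{-t}\,dt$ on $\mathbb{R}$. Theorem. There exist universal constants $\delta_0,\delta_2,\delta_3>0$ such that the following holds for every $p\in(2,\infty)$ with $\frac1p+\frac1q=1$, every $\epsilon\in(0,1)$ and every integer $n\ge 2$. Put $$N=\left\lceil\delta_3n^{\delta_2}\left(\left(\tfrac12+\tfrac1q\right)n\ln n+\ln\tfrac1\epsilon\right)\right\rceil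 ,$$ and let $z_1,\dots,z_N$ be i.i.d. random vectors that are even on $\mathbb{S}_p^n$. Then $$\mathrm{Prob}\left\{\{z_1,\dots,z_N\}\in\mathbb{T}_p^n\left(\sqrt{\frac{\delta_0\ln n}{2n}},\,N\right)\right\}\ge 1-\epsilon .$$ -/

import Mathlib

open MeasureTheory ProbabilityTheory Set
open scoped ENNReal

noncomputable section

namespace LpCovering

/-- The `ℓ_p`-norm of a vector of `ℝⁿ`, for `p ∈ [1, ∞]` (Mathlib's norm of `PiLp`). -/
def lpNorm (p : ℝ≥0∞) {n : ℕ} (x : Fin n → ℝ) : ℝ := ‖WithLp.toLp p x‖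

/-- The `ℓ_p`-sphere `S_p^n = {x ∈ ℝⁿ : ‖x‖_p = 1}`. -/
def lpSphere (p : ℝ≥0∞) (n : ℕ) : Set (Fin n → ℝ) := {x | lpNorm p x = 1}

/-- `H` is a `τ`-hitting set of `S_p^n`, where `q` is the conjugate exponent of `p`: it is a subset
of `S_p^n`, and the caps `{x ∈ S_q^n : xᵀv ≥ τ}`, `v ∈ H`, cover `S_q^n`. -/
structure IsHittingSet (p q : ℝ≥0∞) {n : ℕ} (τ : ℝ) (H : Set (Fin n → ℝ)) : Prop where
  subset_sphere : H ⊆ lpSphere p n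
  ratio_nonneg : 0 ≤ τ
  iUnion_eq : ⋃ v ∈ H, {x | x ∈ lpSphere q n ∧ τ ≤ x ⬝ᵥ v} = lpSphere q n

/-- `T_p^n(τ, m)`: the `τ`-hitting sets of `S_p^n` with at most `m` elements. -/
def hittingSets (p q : ℝ≥0∞) (n : ℕ) (τ : ℝ) (m : ℕ) : Set (Set (Fin n → ℝ)) :=
  {H | IsHittingSet p q τ H ∧ H.encard ≤ m}

/-- The probability density `p e^{-|x|^p} / ∫_0^∞ 2 t^{(1-p)/p} e^{-t} dt` on `ℝ`. -/
def genDensity (p : ℝ) (x : ℝ) : ℝ :=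
  p * Real.exp (-|x| ^ p) / ∫ t in Ioi (0 : ℝ), 2 * t ^ ((1 - p) / p) * Real.exp (-t)

/-- The distribution on `ℝ` with density `genDensity p`. -/
def genMeasure (p : ℝ) : Measure ℝ :=
  volume.withDensity fun x => ENNReal.ofReal (genDensity p x)

/-- The even distribution on `S_p^n`: the law of `y / ‖y‖_p`, where the entries of `y` are i.i.d.
with density `genDensity p`. -/
def evenMeasure (p : ℝ) (n : ℕ) : Measure (Fin n → ℝ) :=
  (Measure.pi fun _ : Fin n => genMeasure p).map
    fun y => (lpNorm (ENNReal.ofReal p) y)⁻¹ • y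

/-- The number of samples `⌈δ₃ n^{δ₂} ((1/2 + 1/q) n ln n + ln (1/ε))⌉`. -/
def sampleSize (δ₂ δ₃ q ε : ℝ) (n : ℕ) : ℕ :=
  ⌈δ₃ * (n : ℝ) ^ δ₂ * ((1 / 2 + 1 / q) * n * Real.log n + Real.log (1 / ε))⌉₊

/-! The explicit formula for the norm, and the proofs that both distributions are probability
measures. -/

theorem lpNorm_ofReal {p : ℝ} (hp : 0 < p) {n : ℕ} (x : Fin n → ℝ) :
    lpNorm (ENNReal.ofReal p) x = (∑ i, |x i| ^ p) ^ (1 / p) := by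
  rw [lpNorm, PiLp.norm_eq_sum (by rw [ENNReal.toReal_ofReal hp.le]; exact hp),
    ENNReal.toReal_ofReal hp.le]
  rfl

theorem isProbabilityMeasure_genMeasure {p : ℝ} (hp : 0 < p) :
    IsProbabilityMeasure (genMeasure p) := by
  have hden : ∫ t in Ioi (0 : ℝ), 2 * t ^ ((1 - p) / p) * Real.exp (-t)
      = 2 * Real.Gamma (1 / p) := by
    rw [Real.Gamma_eq_integral (by positivity), ← integral_const_mul]
    congr 1
    ext t
    rw [show (1 - p) / p = 1 / p - 1 by field_simp]
    ring
  have hG : 0 < Real.Gamma (1 / p) := Real.Gamma_pos_of_pos (by positivity)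
  have hIoi : ∫ x in Ioi (0 : ℝ), Real.exp (-|x| ^ p) = Real.Gamma (1 / p + 1) := by
    rw [← integral_exp_neg_rpow hp]
    exact setIntegral_congr_fun measurableSet_Ioi fun x hx => by
      simp only [abs_of_pos (mem_Ioi.1 hx)]
  have hint : ∫ x : ℝ, Real.exp (-|x| ^ p) = 2 * Real.Gamma (1 / p + 1) := by
    rw [integral_comp_abs (f := fun x => Real.exp (-x ^ p)), ← integral_exp_neg_rpow hp]
  have hi : Integrable fun x : ℝ => Real.exp (-|x| ^ p) := by
    by_contra h
    rw [integral_undef h] at hint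
    have := Real.Gamma_pos_of_pos (show 0 < 1 / p + 1 by positivity)
    linarith
  refine ⟨?_⟩
  rw [genMeasure, withDensity_apply _ MeasurableSet.univ, Measure.restrict_univ,
    ← ofReal_integral_eq_lintegral_ofReal]
  · unfold genDensity
    rw [integral_div, integral_const_mul, hint, hden, Real.Gamma_add_one (by positivity)]
    rw [show p * (2 * (1 / p * Real.Gamma (1 / p))) / (2 * Real.Gamma (1 / p)) = 1 by
      field_simp]
    simp
  · exact (hi.const_mul p).div_const _
  · refine Filter.Eventually.of_forall fun x => ?_
    simp only [genDensity, hden, Pi.zero_apply]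
    positivity

theorem isProbabilityMeasure_evenMeasure {p : ℝ} (hp : 0 < p) (n : ℕ) :
    IsProbabilityMeasure (evenMeasure p n) := by
  have := isProbabilityMeasure_genMeasure hp
  refine Measure.isProbabilityMeasure_map (Measurable.aemeasurable ?_)
  simp_rw [lpNorm_ofReal hp]
  fun_prop

end LpCovering

end

/-!
The heart of the matter is a lower bound for the even measure of a cap: for every `x ∈ S_q^n`, a
vector `v` with the even distribution satisfies `xᵀv ≥ c √(log n / n)` with probability at least
`const * n ^ (-A)`, where `c` and `A` depend neither on `x` nor on `p`
(`exists_le_evenMeasure_cap`). A union bound over a net of `exp (O(n log n))` points of `S_q^n`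
then gives the theorem (`exists_finset_net`, `isHittingSet_of_net`, `card_mul_exp_le`).

For the cap, write `v = y / ‖y‖_p` with `y` having i.i.d. entries, let `k = ⌈log n⌉` and
`a = n ^ (1 / p - 1 / 2)`. It suffices that, with probability at least `exp (-O(k))`,
both `∑ xᵢ yᵢ ≥ c √k a` and `‖y‖_p ^ p ≤ M n`. Both quantities are additive over disjoint blocks
of coordinates, and distinct blocks are independent, so the probability of such an event is
supermultiplicative over blocks (`blockProb_mul_le_union`). Two kinds of blocks are used.

* One coordinate: `|xᵢ| |yᵢ| ≥ |xᵢ| θ / 2` with the right sign costs `exp (-O(1) - θ ^ p)`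
  (`exp_le_blockProb_singleton`).
* Any block `B`: by the Paley–Zygmund inequality and a comparison of second and fourth moments,
  `∑_{i ∈ B} xᵢ yᵢ ≥ c (∑_{i ∈ B} xᵢ²) ^ (1 / 2)` has probability bounded below, and Markov's
  inequality keeps the norm under control at the same time (`exists_exp_le_blockProb`).

Call a coordinate large if `xᵢ² > δ = a² / (8 k)`. If there are at least `k` large coordinates, `k`
of them at the level `θ = 1` are enough. If there are fewer and they carry half of
`∑ |xᵢ| ^ q = 1`, the levels `θᵢ ^ p = k |xᵢ| ^ q` give `∑ |xᵢ| θᵢ ≥ k ^ (1 / p) / 2 ≥ √k a / 2`.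
Otherwise the small coordinates satisfy `∑ xᵢ² ≥ a² / 4`, because `q < 2`, and they split into `k`
blocks with `∑ xᵢ² ≥ δ` each, which contribute `k √δ ≈ √k a`.

All constants are uniform in `p > 2`, since the normalising constant of the density stays between
two absolute constants and the density is dominated by a single Gaussian profile.
-/

noncomputable section

namespace LpCovering

/-! ### The density and its moments -/

theorem exp_neg_one_le_gamma {p : ℝ} (hp : 0 < p) : Real.exp (-1) ≤ Real.Gamma (1 / p + 1) := by
  rw [← integral_exp_neg_rpow hp]
  have hi : IntegrableOn (fun x : ℝ => Real.exp (-x ^ p)) (Ioi 0) := by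
    by_contra h
    have h1 := integral_exp_neg_rpow hp
    rw [integral_undef h] at h1
    have := Real.Gamma_pos_of_pos (show 0 < 1 / p + 1 by positivity)
    linarith
  calc Real.exp (-1) = ∫ x in Ioc (0 : ℝ) 1, Real.exp (-1) := by simp
    _ ≤ ∫ x in Ioc (0 : ℝ) 1, Real.exp (-x ^ p) := by
      refine setIntegral_mono_on (by simp) (hi.mono_set Ioc_subset_Ioi_self) measurableSet_Ioc ?_
      intro x hx
      have := Real.rpow_le_one hx.1.le hx.2 hp.le
      gcongr
    _ ≤ ∫ x in Ioi (0 : ℝ), Real.exp (-x ^ p) :=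
      setIntegral_mono_set hi (Filter.Eventually.of_forall fun x => (Real.exp_pos _).le)
        (Filter.Eventually.of_forall Ioc_subset_Ioi_self)

theorem gamma_one_div_add_one_le_one {p : ℝ} (hp : 1 ≤ p) : Real.Gamma (1 / p + 1) ≤ 1 := by
  have h0 : 0 < 1 / p := by positivity
  have h1 : 1 / p ≤ 1 := by rw [div_le_one (by linarith)]; exact hp
  have h := Real.convexOn_Gamma.2 (mem_Ioi.2 one_pos) (mem_Ioi.2 two_pos)
    (show 0 ≤ 1 - 1 / p by linarith) h0.le (by ring)
  simp only [smul_eq_mul, Real.Gamma_one, Real.Gamma_two] at h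
  rw [show 1 / p + 1 = (1 - 1 / p) * 1 + 1 / p * 2 by ring]
  linarith

theorem genDensity_eq {p : ℝ} (hp : 0 < p) (x : ℝ) :
    genDensity p x = Real.exp (-|x| ^ p) / (2 * Real.Gamma (1 / p + 1)) := by
  have hden : ∫ t in Ioi (0 : ℝ), 2 * t ^ ((1 - p) / p) * Real.exp (-t)
      = 2 * Real.Gamma (1 / p) := by
    rw [Real.Gamma_eq_integral (by positivity), ← integral_const_mul]
    congr 1
    ext t
    rw [show (1 - p) / p = 1 / p - 1 by field_simp]
    ring
  have := Real.Gamma_pos_of_pos (show 0 < 1 / p by positivity)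
  rw [genDensity, hden, Real.Gamma_add_one (by positivity)]
  field_simp

theorem measurable_genDensity {p : ℝ} (hp : 0 < p) : Measurable (genDensity p) := by
  have : genDensity p = fun x => Real.exp (-|x| ^ p) / (2 * Real.Gamma (1 / p + 1)) :=
    funext (genDensity_eq hp)
  rw [this]
  fun_prop

theorem genDensity_nonneg {p : ℝ} (hp : 0 < p) (x : ℝ) : 0 ≤ genDensity p x := by
  have := Real.Gamma_pos_of_pos (show 0 < 1 / p + 1 by positivity)
  rw [genDensity_eq hp]
  positivity

theorem genDensity_neg (p x : ℝ) : genDensity p (-x) = genDensity p x := by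
  simp [genDensity]

/-- The normalising constant of the density is at least `1 / 2`, whatever `p` is. -/
theorem half_mul_exp_le_genDensity {p : ℝ} (hp : 1 ≤ p) (x : ℝ) :
    1 / 2 * Real.exp (-|x| ^ p) ≤ genDensity p x := by
  have h0 := Real.Gamma_pos_of_pos (show 0 < 1 / p + 1 by positivity)
  have h1 := gamma_one_div_add_one_le_one hp
  rw [genDensity_eq (by linarith), le_div_iff₀ (by positivity)]
  nlinarith [Real.exp_pos (-|x| ^ p)]

/-- For `p ≥ 2` the density is dominated by one Gaussian profile, uniformly in `p`. -/
theorem genDensity_le_exp_neg_sq {p : ℝ} (hp : 2 ≤ p) (x : ℝ) :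
    genDensity p x ≤ Real.exp 2 * Real.exp (-1 * x ^ 2) := by
  have h1 := exp_neg_one_le_gamma (show 0 < p by linarith)
  have h2 : |x| ^ 2 ≤ 1 + |x| ^ p := by
    rcases le_total |x| 1 with h | h
    · have : 0 ≤ |x| ^ p := by positivity
      nlinarith [abs_nonneg x]
    · have := Real.rpow_le_rpow_of_exponent_le h hp
      rw [Real.rpow_two] at this
      linarith
  rw [sq_abs] at h2
  rw [genDensity_eq (by linarith), div_le_iff₀ (by have := Real.exp_pos (-1); linarith)]
  have h3 : Real.exp (-|x| ^ p) ≤ Real.exp 1 * Real.exp (-1 * x ^ 2) := by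
    rw [← Real.exp_add]
    gcongr
    linarith
  have h4 : Real.exp 1 * Real.exp (-1 * x ^ 2)
      = Real.exp 2 * Real.exp (-1 * x ^ 2) * Real.exp (-1) := by
    simp only [← Real.exp_add]
    congr 1
    ring
  have h5 : 0 ≤ Real.exp 2 * Real.exp (-1 * x ^ 2) := by positivity
  have h6 := Real.exp_pos (-1)
  nlinarith

theorem integrable_genMeasure_iff {p : ℝ} (hp : 0 < p) {f : ℝ → ℝ} :
    Integrable f (genMeasure p) ↔ Integrable fun x => genDensity p x * f x := by
  rw [genMeasure, integrable_withDensity_iff_integrable_smul'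
    (measurable_genDensity hp).ennreal_ofReal (by simp)]
  simp [ENNReal.toReal_ofReal (genDensity_nonneg hp _)]

theorem integral_genMeasure {p : ℝ} (hp : 0 < p) (f : ℝ → ℝ) :
    ∫ x, f x ∂genMeasure p = ∫ x, genDensity p x * f x := by
  rw [genMeasure, integral_withDensity_eq_integral_toReal_smul
    (measurable_genDensity hp).ennreal_ofReal (by simp)]
  simp [ENNReal.toReal_ofReal (genDensity_nonneg hp _)]

theorem isNegInvariant_genMeasure {p : ℝ} (hp : 0 < p) : (genMeasure p).IsNegInvariant := by
  refine ⟨Measure.ext fun s hs => ?_⟩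
  have hm := (measurable_genDensity hp).ennreal_ofReal
  rw [Measure.neg, Measure.map_apply measurable_neg hs, genMeasure,
    withDensity_apply _ hs, withDensity_apply _ (measurable_neg hs),
    ← (Measure.measurePreserving_neg (volume : Measure ℝ)).setLIntegral_comp_preimage hs hm]
  simp [genDensity_neg]

theorem nullSingletonClass_genMeasure (p : ℝ) : NullSingletonClass (genMeasure p) :=
  ⟨fun x => withDensity_absolutelyContinuous _ _ (by simp)⟩

theorem integrable_pow_genMeasure {p : ℝ} (hp : 2 ≤ p) (j : ℕ) :
    Integrable (fun x => x ^ j) (genMeasure p) := by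
  rw [integrable_genMeasure_iff (by linarith)]
  have h := integrable_rpow_mul_exp_neg_mul_sq (b := 1) one_pos (s := j)
    (by have : (0 : ℝ) ≤ j := by positivity
        linarith)
  refine (h.const_mul (Real.exp 2)).mono
    ((measurable_genDensity (by linarith)).mul (by fun_prop)).aestronglyMeasurable ?_
  refine Filter.Eventually.of_forall fun x => ?_
  have h1 := genDensity_le_exp_neg_sq hp x
  have h0 := genDensity_nonneg (show 0 < p by linarith) x
  simp only [norm_mul, Real.norm_eq_abs, abs_of_nonneg h0, Real.rpow_natCast, Real.abs_exp]
  calc _ ≤ Real.exp 2 * Real.exp (-1 * x ^ 2) * |x ^ j| := by gcongr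
    _ = _ := by ring

/-- The bound on the fourth moment is the same for all `p`. -/
theorem exists_fourth_moment_le :
    ∃ C : ℝ, 1 ≤ C ∧ ∀ p : ℝ, 2 ≤ p → ∫ x, x ^ 4 ∂genMeasure p ≤ C := by
  refine ⟨max 1 (∫ x : ℝ, Real.exp 2 * (x ^ (4 : ℝ) * Real.exp (-1 * x ^ 2))),
    le_max_left _ _, fun p hp => le_max_of_le_right ?_⟩
  rw [integral_genMeasure (by linarith)]
  refine integral_mono ((integrable_genMeasure_iff (by linarith)).1
    (integrable_pow_genMeasure hp 4)) ?_ fun x => ?_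
  · exact (integrable_rpow_mul_exp_neg_mul_sq (b := 1) one_pos (s := 4) (by norm_num)).const_mul _
  · have h1 := genDensity_le_exp_neg_sq hp x
    have h2 : x ^ (4 : ℝ) = x ^ 4 := by exact_mod_cast Real.rpow_natCast x 4
    simp only [h2]
    calc _ ≤ Real.exp 2 * Real.exp (-1 * x ^ 2) * x ^ 4 := by gcongr
      _ = _ := by ring

theorem integral_odd_pow_genMeasure {p : ℝ} (hp : 0 < p) {j : ℕ} (hj : Odd j) :
    ∫ x, x ^ j ∂genMeasure p = 0 := by
  have := isNegInvariant_genMeasure hp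
  have h := integral_neg_eq_self (fun x : ℝ => x ^ j) (genMeasure p)
  simp only [hj.neg_pow, integral_neg] at h
  linarith

theorem mul_exp_le_measure_Icc {p : ℝ} (hp : 1 ≤ p) {a b : ℝ} (ha : 0 ≤ a) :
    (b - a) / 2 * Real.exp (-b ^ p) ≤ (genMeasure p).real (Icc a b) := by
  have := isProbabilityMeasure_genMeasure (show 0 < p by linarith)
  rw [measureReal_def, ← ENNReal.ofReal_le_iff_le_toReal (measure_ne_top _ _), genMeasure,
    withDensity_apply _ measurableSet_Icc]
  calc ENNReal.ofReal ((b - a) / 2 * Real.exp (-b ^ p))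
      = ∫⁻ _ in Icc a b, ENNReal.ofReal (1 / 2 * Real.exp (-b ^ p)) := by
        rw [setLIntegral_const, Real.volume_Icc, ← ENNReal.ofReal_mul (by positivity)]
        congr 1
        ring
    _ ≤ _ := by
        refine setLIntegral_mono' measurableSet_Icc fun x hx => ENNReal.ofReal_le_ofReal ?_
        refine le_trans ?_ (half_mul_exp_le_genDensity hp x)
        rw [abs_of_nonneg (ha.trans hx.1)]
        have := Real.rpow_le_rpow (ha.trans hx.1) hx.2 (show 0 ≤ p by linarith)
        gcongr

/-- The bound comes from the mass of the interval `[1 / 2, 1]` alone. -/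
theorem le_second_moment {p : ℝ} (hp : 2 ≤ p) : 1 / 64 ≤ ∫ x, x ^ 2 ∂genMeasure p := by
  have := isProbabilityMeasure_genMeasure (show 0 < p by linarith)
  have h := mul_exp_le_measure_Icc (show 1 ≤ p by linarith) (a := 1 / 2) (b := 1)
    (by norm_num)
  have hM := mul_meas_ge_le_integral_of_nonneg
    (Filter.Eventually.of_forall fun x : ℝ => sq_nonneg x) (integrable_pow_genMeasure hp 2) (1 / 4)
  have hsub : Icc (1 / 2 : ℝ) 1 ⊆ {x | 1 / 4 ≤ x ^ 2} := fun x hx => by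
    simp only [mem_ofPred_eq]
    nlinarith [hx.1]
  have h2 := measureReal_mono (μ := genMeasure p) hsub
  have h3 : (1 / 4 : ℝ) ≤ Real.exp (-1) := by
    rw [Real.exp_neg, one_div]
    have := Real.exp_one_lt_d9
    gcongr
    linarith
  rw [Real.one_rpow] at h
  linarith

/-- `|y| ^ p` has mean `1 / p`. Its integrability follows from the value of the integral, which is
not the default value `0`. -/
theorem integral_abs_rpow_genMeasure {p : ℝ} (hp : 0 < p) :
    Integrable (fun x => |x| ^ p) (genMeasure p) ∧ ∫ x, |x| ^ p ∂genMeasure p = 1 / p := by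
  have hG := Real.Gamma_pos_of_pos (show 0 < 1 / p + 1 by positivity)
  have h : ∫ x : ℝ, genDensity p x * |x| ^ p = 1 / p := by
    have h1 := integral_comp_abs
      (f := fun x => Real.exp (-x ^ p) / (2 * Real.Gamma (1 / p + 1)) * x ^ p)
    simp only [genDensity_eq hp]
    rw [h1]
    have h2 : ∀ x : ℝ, Real.exp (-x ^ p) / (2 * Real.Gamma (1 / p + 1)) * x ^ p
        = (2 * Real.Gamma (1 / p + 1))⁻¹ * (x ^ p * Real.exp (-x ^ p)) := fun x => by
      ring
    simp only [h2]
    rw [integral_const_mul, integral_rpow_mul_exp_neg_rpow hp (by linarith),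
      show (p + 1) / p = 1 / p + 1 by field_simp; ring]
    field_simp
  refine ⟨?_, by rw [integral_genMeasure hp, h]⟩
  rw [integrable_genMeasure_iff hp]
  by_contra hn
  rw [integral_undef hn] at h
  have : 0 < 1 / p := by positivity
  linarith

/-! ### Moments of sums of independent variables -/

/-- A Paley–Zygmund inequality: the second moment of `Z` controls how far `Z` may stay below
its mean. -/
theorem le_measureReal_half_mean_le {Ω : Type*} [MeasurableSpace Ω] {μ : Measure Ω}
    [IsProbabilityMeasure μ] {Z : Ω → ℝ} (hZm : Measurable Z) (hZ : Integrable Z μ)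
    (hZ2 : Integrable (fun ω => Z ω ^ 2) μ) {m L : ℝ} (hm : 0 < m) (hL : 0 < L)
    (h1 : m ≤ ∫ ω, Z ω ∂μ) (h2 : ∫ ω, Z ω ^ 2 ∂μ ≤ L * m ^ 2) :
    1 / (4 * L) ≤ μ.real {ω | m / 2 ≤ Z ω} := by
  have hA : MeasurableSet {ω | m / 2 ≤ Z ω} := measurableSet_le measurable_const hZm
  have hind : Integrable ({ω | m / 2 ≤ Z ω}.indicator fun _ => L * m) μ :=
    (integrable_const (L * m)).indicator hA
  -- On the event, `Z ≤ Z² / (4Lm) + Lm` by the inequality of the means.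
  have hpt : ∀ ω, Z ω ≤ m / 2 + 1 / (4 * L * m) * Z ω ^ 2
      + {ω | m / 2 ≤ Z ω}.indicator (fun _ => L * m) ω := by
    intro ω
    have h0 : 0 ≤ 1 / (4 * L * m) * Z ω ^ 2 := by positivity
    by_cases h : m / 2 ≤ Z ω
    · rw [indicator_of_mem (by exact h)]
      have : 1 / (4 * L * m) * Z ω ^ 2 + L * m - Z ω
          = 1 / (4 * L * m) * (Z ω - 2 * L * m) ^ 2 := by
        field_simp
        ring
      have : 0 ≤ 1 / (4 * L * m) * (Z ω - 2 * L * m) ^ 2 := by positivity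
      linarith
    · rw [indicator_of_notMem (by exact h)]
      push Not at h
      linarith
  have hi1 : Integrable (fun ω => m / 2 + 1 / (4 * L * m) * Z ω ^ 2) μ :=
    (integrable_const (m / 2)).add (hZ2.const_mul _)
  have hi := integral_mono hZ (hi1.add hind) hpt
  rw [integral_add' hi1 hind,
    integral_add (integrable_const _) (hZ2.const_mul _), integral_const_mul,
    integral_indicator_const _ hA] at hi
  simp only [integral_const, probReal_univ, smul_eq_mul, one_mul] at hi
  have h3 : 1 / (4 * L * m) * ∫ ω, Z ω ^ 2 ∂μ ≤ m / 4 := by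
    calc _ ≤ 1 / (4 * L * m) * (L * m ^ 2) := by gcongr
      _ = m / 4 := by field_simp
  have h4 : m * (1 / 4) ≤ m * (μ.real {ω | m / 2 ≤ Z ω} * L) := by linarith
  have h5 := le_of_mul_le_mul_left h4 hm
  rw [div_le_iff₀ (by positivity)]
  linarith

section Moments

variable {Ω : Type*} [MeasurableSpace Ω] {μ : Measure Ω}

theorem integrable_pow_add_of_indepFun {X Y : Ω → ℝ} (hXY : IndepFun X Y μ)
    (hX : ∀ j : ℕ, Integrable (fun ω => X ω ^ j) μ)
    (hY : ∀ j : ℕ, Integrable (fun ω => Y ω ^ j) μ) (j : ℕ) :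
    Integrable (fun ω => (X ω + Y ω) ^ j) μ := by
  simp only [add_pow]
  refine integrable_finsetSum _ fun k _ => Integrable.mul_const ?_ _
  exact (hXY.comp (measurable_id.pow_const k) (measurable_id.pow_const (j - k))).integrable_mul
    (hX k) (hY (j - k))

theorem integral_pow_mul_pow_of_indepFun {X Y : Ω → ℝ} (hXY : IndepFun X Y μ)
    (hX : ∀ j : ℕ, Integrable (fun ω => X ω ^ j) μ)
    (hY : ∀ j : ℕ, Integrable (fun ω => Y ω ^ j) μ) (j k : ℕ) :
    Integrable (fun ω => X ω ^ j * Y ω ^ k) μ ∧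
      ∫ ω, X ω ^ j * Y ω ^ k ∂μ = (∫ ω, X ω ^ j ∂μ) * ∫ ω, Y ω ^ k ∂μ := by
  have h := hXY.comp (measurable_id.pow_const j) (measurable_id.pow_const k)
  exact ⟨h.integrable_mul (hX j) (hY k),
    h.integral_mul_eq_mul_integral (hX j).aestronglyMeasurable (hY k).aestronglyMeasurable⟩

theorem integral_sq_add_of_indepFun {X Y : Ω → ℝ} (hXY : IndepFun X Y μ)
    (hX : ∀ j : ℕ, Integrable (fun ω => X ω ^ j) μ)
    (hY : ∀ j : ℕ, Integrable (fun ω => Y ω ^ j) μ)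
    (hY1 : ∫ ω, Y ω ∂μ = 0) :
    ∫ ω, (X ω + Y ω) ^ 2 ∂μ = ∫ ω, X ω ^ 2 ∂μ + ∫ ω, Y ω ^ 2 ∂μ := by
  have h11 := integral_pow_mul_pow_of_indepFun hXY hX hY 1 1
  simp only [pow_one, hY1, mul_zero] at h11
  have he : ∀ ω, (X ω + Y ω) ^ 2 = X ω ^ 2 + 2 * (X ω * Y ω) + Y ω ^ 2 := fun ω => by ring
  simp only [he]
  have hi : Integrable (fun ω => X ω ^ 2 + 2 * (X ω * Y ω)) μ :=
    (hX 2).add (h11.1.const_mul 2)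
  rw [integral_add hi (hY 2),
    integral_add (hX 2) (h11.1.const_mul 2), integral_const_mul, h11.2]
  ring

theorem integral_pow_four_add_of_indepFun {X Y : Ω → ℝ} (hXY : IndepFun X Y μ)
    (hX : ∀ j : ℕ, Integrable (fun ω => X ω ^ j) μ)
    (hY : ∀ j : ℕ, Integrable (fun ω => Y ω ^ j) μ) (hX1 : ∫ ω, X ω ∂μ = 0)
    (hY1 : ∫ ω, Y ω ∂μ = 0) :
    ∫ ω, (X ω + Y ω) ^ 4 ∂μ = ∫ ω, X ω ^ 4 ∂μ
      + 6 * ((∫ ω, X ω ^ 2 ∂μ) * ∫ ω, Y ω ^ 2 ∂μ) + ∫ ω, Y ω ^ 4 ∂μ := by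
  have h31 := integral_pow_mul_pow_of_indepFun hXY hX hY 3 1
  have h22 := integral_pow_mul_pow_of_indepFun hXY hX hY 2 2
  have h13 := integral_pow_mul_pow_of_indepFun hXY hX hY 1 3
  simp only [pow_one, hY1, hX1, mul_zero, zero_mul] at h31 h13
  have he : ∀ ω, (X ω + Y ω) ^ 4 = X ω ^ 4 + 4 * (X ω ^ 3 * Y ω) + 6 * (X ω ^ 2 * Y ω ^ 2)
      + 4 * (X ω * Y ω ^ 3) + Y ω ^ 4 := fun ω => by ring
  simp only [he]
  have i1 : Integrable (fun ω => X ω ^ 4 + 4 * (X ω ^ 3 * Y ω)) μ :=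
    (hX 4).add (h31.1.const_mul 4)
  have i2 : Integrable (fun ω => X ω ^ 4 + 4 * (X ω ^ 3 * Y ω) + 6 * (X ω ^ 2 * Y ω ^ 2)) μ :=
    i1.add (h22.1.const_mul 6)
  have i3 : Integrable (fun ω => X ω ^ 4 + 4 * (X ω ^ 3 * Y ω) + 6 * (X ω ^ 2 * Y ω ^ 2)
      + 4 * (X ω * Y ω ^ 3)) μ := i2.add (h13.1.const_mul 4)
  rw [integral_add i3 (hY 4), integral_add i2 (h13.1.const_mul 4),
    integral_add i1 (h22.1.const_mul 6), integral_add (hX 4) (h31.1.const_mul 4),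
    integral_const_mul, integral_const_mul, integral_const_mul, h31.2, h22.2, h13.2]
  ring

/-- The first, second and fourth moments of a linear combination of independent centred variables
with common second moment `v`. The fourth moment is comparable with the square of the second, as
for a Gaussian. -/
theorem moments_sum_mul [IsProbabilityMeasure μ] {ι : Type*} {Y : ι → Ω → ℝ} (hY : iIndepFun Y μ)
    (hYm : ∀ i, Measurable (Y i)) (hYi : ∀ i, ∀ j : ℕ, Integrable (fun ω => Y i ω ^ j) μ)
    (h1 : ∀ i, ∫ ω, Y i ω ∂μ = 0) {v C : ℝ} (hC : 1 ≤ C) (hvC : v ≤ C)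
    (h2 : ∀ i, ∫ ω, Y i ω ^ 2 ∂μ = v) (h4 : ∀ i, ∫ ω, Y i ω ^ 4 ∂μ ≤ C) (x : ι → ℝ)
    (B : Finset ι) :
    (∀ j : ℕ, Integrable (fun ω => (∑ i ∈ B, x i * Y i ω) ^ j) μ) ∧
      ∫ ω, ∑ i ∈ B, x i * Y i ω ∂μ = 0 ∧
      ∫ ω, (∑ i ∈ B, x i * Y i ω) ^ 2 ∂μ = v * ∑ i ∈ B, x i ^ 2 ∧
      ∫ ω, (∑ i ∈ B, x i * Y i ω) ^ 4 ∂μ ≤ 3 * C ^ 2 * (∑ i ∈ B, x i ^ 2) ^ 2 := by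
  classical
  induction B using Finset.induction_on with
  | empty => simp
  | insert a s ha ih =>
    obtain ⟨ihi, ih1, ih2, ih4⟩ := ih
    have hind : IndepFun (fun ω => ∑ i ∈ s, x i * Y i ω) (fun ω => x a * Y a ω) μ := by
      have h := (hY.comp (fun i y => x i * y) fun i => measurable_const_mul (x i)
        ).indepFun_finsetSum_of_notMem (fun i => (measurable_const_mul (x i)).comp (hYm i)) ha
      convert h using 1
      · ext ω
        simp
      · rfl
    have hYi' : ∀ j : ℕ, Integrable (fun ω => (x a * Y a ω) ^ j) μ := fun j => by
      simp only [mul_pow]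
      exact (hYi a j).const_mul _
    have hY1' : ∫ ω, x a * Y a ω ∂μ = 0 := by rw [integral_const_mul, h1, mul_zero]
    have hY2' : ∫ ω, (x a * Y a ω) ^ 2 ∂μ = v * x a ^ 2 := by
      simp only [mul_pow]
      rw [integral_const_mul, h2, mul_comm]
    have hY4' : ∫ ω, (x a * Y a ω) ^ 4 ∂μ ≤ C * x a ^ 4 := by
      simp only [mul_pow]
      rw [integral_const_mul, mul_comm]
      have := h4 a
      gcongr
    have hv : 0 ≤ v := by
      rw [← h2 a]
      exact integral_nonneg fun ω => sq_nonneg _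
    simp only [Finset.sum_insert ha, add_comm (x a * _), add_comm (x a ^ 2)]
    refine ⟨integrable_pow_add_of_indepFun hind ihi hYi', ?_, ?_, ?_⟩
    · have i1 := ihi 1
      have i2 := hYi' 1
      simp only [pow_one] at i1 i2
      rw [integral_add i1 i2, ih1, hY1', add_zero]
    · rw [integral_sq_add_of_indepFun hind ihi hYi' hY1', ih2, hY2', mul_add]
    · rw [integral_pow_four_add_of_indepFun hind ihi hYi' ih1 hY1', ih2, hY2']
      set S := ∑ i ∈ s, x i ^ 2
      have hS : 0 ≤ S := Finset.sum_nonneg fun i _ => sq_nonneg _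
      have e1 : 6 * (v * S * (v * x a ^ 2)) ≤ 6 * (C * S * (C * x a ^ 2)) := by gcongr
      have e2 : C * x a ^ 4 ≤ 3 * C ^ 2 * x a ^ 4 := by
        gcongr
        nlinarith
      calc _ ≤ 3 * C ^ 2 * S ^ 2 + 6 * (C * S * (C * x a ^ 2)) + 3 * C ^ 2 * x a ^ 4 := by
            linarith
        _ = _ := by ring

end Moments

/-! ### Blocks of coordinates -/

/-- The probability that the coordinates of `y` in `B`, for `y` with i.i.d. entries of density
`genDensity p`, contribute at least `t` to the inner product with `x` and at most `M` to
`‖y‖_p ^ p`. -/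
def blockProb (p : ℝ) {n : ℕ} (x : Fin n → ℝ) (B : Finset (Fin n)) (t M : ℝ) : ℝ :=
  (Measure.pi fun _ : Fin n => genMeasure p).real
    {y | t ≤ ∑ i ∈ B, x i * y i ∧ ∑ i ∈ B, |y i| ^ p ≤ M}

theorem blockProb_mono {p : ℝ} (hp : 0 < p) {n : ℕ} (x : Fin n → ℝ) (B : Finset (Fin n))
    {t t' M M' : ℝ} (ht : t' ≤ t) (hM : M ≤ M') : blockProb p x B t M ≤ blockProb p x B t' M' := by
  have := isProbabilityMeasure_genMeasure hp
  exact measureReal_mono fun y hy => ⟨ht.trans hy.1, hy.2.trans hM⟩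

theorem iIndepFun_coord {p : ℝ} (hp : 0 < p) (n : ℕ) :
    iIndepFun (fun (i : Fin n) (y : Fin n → ℝ) => y i)
      (Measure.pi fun _ : Fin n => genMeasure p) := by
  have := isProbabilityMeasure_genMeasure hp
  exact iIndepFun_pi (X := fun _ => id) fun _ => aemeasurable_id

theorem blockProb_mul_le_union {p : ℝ} (hp : 0 < p) {n : ℕ} (x : Fin n → ℝ)
    {B B' : Finset (Fin n)} (hB : Disjoint B B') (t t' M M' : ℝ) :
    blockProb p x B t M * blockProb p x B' t' M' ≤
      blockProb p x (B ∪ B') (t + t') (M + M') := by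
  have := isProbabilityMeasure_genMeasure hp
  let E : ∀ S : Finset (Fin n), ℝ → ℝ → Set (S → ℝ) := fun S t M =>
    {u | t ≤ ∑ i : S, x i * u i ∧ ∑ i : S, |u i| ^ p ≤ M}
  have hE : ∀ S t M, MeasurableSet (E S t M) := fun S t M => by
    have h1 : MeasurableSet {u : S → ℝ | t ≤ ∑ i : S, x i * u i} :=
      measurableSet_le measurable_const (by fun_prop)
    have h2 : MeasurableSet {u : S → ℝ | ∑ i : S, |u i| ^ p ≤ M} :=
      measurableSet_le (by fun_prop) measurable_const
    exact h1.inter h2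
  have hpre : ∀ S t M, {y : Fin n → ℝ | t ≤ ∑ i ∈ S, x i * y i ∧ ∑ i ∈ S, |y i| ^ p ≤ M}
      = (fun (y : Fin n → ℝ) (i : S) => y i) ⁻¹' E S t M := fun S t M => by
    ext y
    simp only [E, mem_preimage, mem_ofPred_eq, Finset.univ_eq_attach]
    rw [Finset.sum_attach S fun i => x i * y i, Finset.sum_attach S fun i => |y i| ^ p]
  have hind := (iIndepFun_coord hp n).indepFun_finset B B' hB fun i => measurable_pi_apply i
  have h := hind.measure_inter_preimage_eq_mul _ _ (hE B t M) (hE B' t' M')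
  rw [← hpre, ← hpre] at h
  rw [blockProb, blockProb, measureReal_def, measureReal_def, ← ENNReal.toReal_mul, ← h,
    ← measureReal_def]
  refine measureReal_mono fun y hy => ?_
  obtain ⟨⟨h1, h2⟩, h3, h4⟩ := hy
  refine ⟨?_, ?_⟩ <;> rw [Finset.sum_union hB] <;> linarith

theorem one_le_blockProb_empty {p : ℝ} (hp : 0 < p) {n : ℕ} (x : Fin n → ℝ) :
    1 ≤ blockProb p x ∅ 0 0 := by
  have := isProbabilityMeasure_genMeasure hp
  simp [blockProb]

theorem prod_blockProb_le_biUnion {p : ℝ} (hp : 0 < p) {n : ℕ} (x : Fin n → ℝ) {ι : Type*}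
    [DecidableEq ι] (s : Finset ι) (B : ι → Finset (Fin n)) (t M : ι → ℝ)
    (hB : ∀ i ∈ s, ∀ j ∈ s, i ≠ j → Disjoint (B i) (B j)) :
    ∏ j ∈ s, blockProb p x (B j) (t j) (M j) ≤
      blockProb p x (s.biUnion B) (∑ j ∈ s, t j) (∑ j ∈ s, M j) := by
  induction s using Finset.induction_on with
  | empty => simpa using one_le_blockProb_empty hp x
  | insert a s ha ih =>
    rw [Finset.prod_insert ha, Finset.sum_insert ha, Finset.sum_insert ha, Finset.biUnion_insert]
    refine le_trans ?_ (blockProb_mul_le_union hp x ?_ _ _ _ _)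
    · refine mul_le_mul_of_nonneg_left (ih fun i hi j hj => hB i (Finset.mem_insert_of_mem hi) j
        (Finset.mem_insert_of_mem hj)) measureReal_nonneg
    · rw [Finset.disjoint_biUnion_right]
      intro j hj
      exact hB a (Finset.mem_insert_self _ _) j (Finset.mem_insert_of_mem hj)
        fun h => ha (h ▸ hj)

/-- A single coordinate reaches the level `θ / 2` at the cost `exp (-O(1) - θ ^ p)`. -/
theorem exp_le_blockProb_singleton {p : ℝ} (hp : 1 ≤ p) {n : ℕ} (x : Fin n → ℝ) (i : Fin n)
    {θ : ℝ} (hθ : 0 ≤ θ) :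
    Real.exp (-3 - θ ^ p) ≤ blockProb p x {i} (|x i| * (θ / 2)) (1 + θ ^ p) := by
  have hp0 : 0 < p := by linarith
  have := isProbabilityMeasure_genMeasure hp0
  have := isNegInvariant_genMeasure hp0
  -- With `b = max θ 1` the interval `[b / 2, b]` has length at least `1 / 2`, also for small `θ`.
  set b := max θ 1
  have hb1 : 1 ≤ b := le_max_right _ _
  have hbθ : θ ≤ b := le_max_left _ _
  have hbp : b ^ p ≤ 1 + θ ^ p := by
    have h0 := Real.rpow_nonneg hθ p
    rcases le_total θ 1 with h | h
    · simp only [b, max_eq_right h, Real.one_rpow]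
      linarith
    · simp only [b, max_eq_left h]
      linarith
  have hI := mul_exp_le_measure_Icc hp (a := b / 2) (b := b) (by linarith)
  have hexp : Real.exp (-3 - θ ^ p) ≤ (b - b / 2) / 2 * Real.exp (-b ^ p) := by
    have h2 : Real.exp (-2) ≤ 1 / 4 := by
      rw [show (-2 : ℝ) = -1 + -1 by norm_num, Real.exp_add, Real.exp_neg]
      have := Real.exp_one_gt_d9
      have : (Real.exp 1)⁻¹ ≤ 1 / 2 := by
        rw [one_div]
        gcongr
        linarith
      have h0 : 0 < (Real.exp 1)⁻¹ := by positivity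
      nlinarith
    calc Real.exp (-3 - θ ^ p) = Real.exp (-2) * Real.exp (-(1 + θ ^ p)) := by
          rw [← Real.exp_add]
          ring_nf
      _ ≤ (b - b / 2) / 2 * Real.exp (-b ^ p) := by
          gcongr
          all_goals linarith
  have key : ∀ S : Set ℝ, MeasurableSet S → (genMeasure p).real S = (genMeasure p).real
      (Icc (b / 2) b) → (∀ u ∈ S, |x i| * (θ / 2) ≤ x i * u ∧ |u| ≤ b) →
      Real.exp (-3 - θ ^ p) ≤ blockProb p x {i} (|x i| * (θ / 2)) (1 + θ ^ p) := by
    intro S hS hSm hSu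
    have hpre := (measurePreserving_eval (fun _ : Fin n => genMeasure p) i).measureReal_preimage
      hS.nullMeasurableSet
    refine (hexp.trans hI).trans ?_
    rw [← hSm, ← hpre]
    refine measureReal_mono fun y hy => ?_
    obtain ⟨h1, h2⟩ := hSu (y i) hy
    simp only [Finset.sum_singleton, mem_ofPred_eq]
    exact ⟨h1, (Real.rpow_le_rpow (abs_nonneg _) h2 hp0.le).trans hbp⟩
  rcases le_total 0 (x i) with hx | hx
  · refine key (Icc (b / 2) b) measurableSet_Icc rfl fun u hu => ⟨?_, ?_⟩
    · rw [abs_of_nonneg hx]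
      have := hu.1
      gcongr
      linarith
    · rw [abs_of_nonneg (by linarith [hu.1])]
      exact hu.2
  · refine key (-Icc (b / 2) b) measurableSet_Icc.neg ?_ fun u hu => ?_
    · rw [measureReal_def, Measure.measure_neg, measureReal_def]
    · rw [mem_neg] at hu
      refine ⟨?_, ?_⟩
      · rw [abs_of_nonpos hx]
        nlinarith [hu.1]
      · rw [abs_of_nonpos (by linarith [hu.1])]
        exact hu.2

theorem measureReal_sum_abs_rpow_tail {p : ℝ} (hp : 1 ≤ p) {n : ℕ} (B : Finset (Fin n)) {K : ℝ}
    (hK : 0 < K) :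
    (Measure.pi fun _ : Fin n => genMeasure p).real {y | K * B.card < ∑ i ∈ B, |y i| ^ p}
      ≤ 1 / K := by
  have hp0 : 0 < p := by linarith
  have := isProbabilityMeasure_genMeasure hp0
  rcases B.eq_empty_or_nonempty with rfl | hB
  · simp only [Finset.sum_empty, Finset.card_empty, Nat.cast_zero, mul_zero, lt_irrefl]
    have : 0 ≤ 1 / K := by positivity
    simpa using this
  have hcard : (0 : ℝ) < B.card := by exact_mod_cast hB.card_pos
  obtain ⟨h1, h2⟩ := integral_abs_rpow_genMeasure hp0
  have hi : ∀ i : Fin n, Integrable (fun y : Fin n → ℝ => |y i| ^ p)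
      (Measure.pi fun _ : Fin n => genMeasure p) := fun i =>
    (measurePreserving_eval (fun _ : Fin n => genMeasure p) i).integrable_comp_of_integrable h1
  have hint : ∀ i : Fin n, ∫ y : Fin n → ℝ, |y i| ^ p ∂(Measure.pi fun _ => genMeasure p)
      = 1 / p := fun i => by
    rw [← h2]
    exact integral_comp_eval (i := i) (f := fun u => |u| ^ p) h1.aestronglyMeasurable
  have hM := mul_meas_ge_le_integral_of_nonneg (μ := Measure.pi fun _ : Fin n => genMeasure p)
    (f := fun y => ∑ i ∈ B, |y i| ^ p)
    (Filter.Eventually.of_forall fun y => Finset.sum_nonneg fun i _ => by positivity)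
    (integrable_finsetSum _ fun i _ => hi i) (K * B.card)
  rw [integral_finsetSum _ fun i _ => hi i] at hM
  simp only [hint, Finset.sum_const, nsmul_eq_mul] at hM
  have h3 : 1 / p ≤ 1 := by
    rw [div_le_one hp0]
    exact hp
  have h4 : (B.card : ℝ) * (1 / p) ≤ B.card * 1 := by gcongr
  have h5 := measureReal_mono (μ := Measure.pi fun _ : Fin n => genMeasure p)
    (s₁ := {y | K * B.card < ∑ i ∈ B, |y i| ^ p})
    (s₂ := {y | K * B.card ≤ ∑ i ∈ B, |y i| ^ p}) fun y hy => by
      simp only [mem_ofPred_eq] at hy ⊢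
      exact hy.le
  refine h5.trans ?_
  rw [le_div_iff₀ hK]
  refine le_of_mul_le_mul_left ?_ hcard
  calc _ = K * B.card * (Measure.pi fun _ : Fin n => genMeasure p).real
        {y | K * B.card ≤ ∑ i ∈ B, |y i| ^ p} := by ring
    _ ≤ _ := hM.trans h4

theorem measureReal_le_sum_eq_le_neg_sum {p : ℝ} (hp : 0 < p) {n : ℕ} (x : Fin n → ℝ)
    (B : Finset (Fin n)) (s : ℝ) :
    (Measure.pi fun _ : Fin n => genMeasure p).real {y | s ≤ -∑ i ∈ B, x i * y i}
      = (Measure.pi fun _ : Fin n => genMeasure p).real {y | s ≤ ∑ i ∈ B, x i * y i} := by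
  have := isProbabilityMeasure_genMeasure hp
  have := isNegInvariant_genMeasure hp
  have h := Measure.measure_neg (Measure.pi fun _ : Fin n => genMeasure p)
    {y | s ≤ ∑ i ∈ B, x i * y i}
  rw [measureReal_def, measureReal_def, ← h]
  congr 2
  ext y
  simp

/-- On any block, the inner product exceeds a fixed multiple of its standard deviation, and the
contribution to the norm stays of the order of its mean, with a probability bounded below
independently of `p`, of the block and of `x`. -/
theorem exists_exp_le_blockProb :
    ∃ c K A : ℝ, 0 < c ∧ 1 ≤ K ∧ 4 ≤ A ∧ ∀ (p : ℝ), 2 ≤ p → ∀ (n : ℕ) (x : Fin n → ℝ)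
      (B : Finset (Fin n)),
      Real.exp (-A) ≤ blockProb p x B (c * √(∑ i ∈ B, x i ^ 2)) (K * B.card) := by
  obtain ⟨C, hC1, hC⟩ := exists_fourth_moment_le
  -- `L` bounds the fourth moment `3 C² S²` of the sum by the square of the lower bound `S / 64` for
  -- its second moment. With `K = 16 L` the norm costs `1 / (16 L)`, half of the probability
  -- `1 / (8 L)` that Paley–Zygmund and symmetry give for the inner product.
  set L : ℝ := 3 * C ^ 2 * 64 ^ 2 with hL
  have hL1 : 64 ≤ L := by nlinarith
  refine ⟨1 / 12, 16 * L, Real.log (16 * L), by norm_num, by linarith, ?_, fun p hp n x B => ?_⟩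
  · rw [Real.le_log_iff_exp_le (by linarith)]
    have h3 := Real.exp_one_lt_d9
    have : Real.exp 4 = Real.exp 1 ^ 4 := by rw [← Real.exp_nat_mul]; norm_num
    rw [this]
    calc Real.exp 1 ^ 4 ≤ 2.72 ^ 4 := by gcongr; linarith
      _ ≤ 16 * L := by norm_num; linarith
  have hp0 : 0 < p := by linarith
  have := isProbabilityMeasure_genMeasure hp0
  set μ := Measure.pi fun _ : Fin n => genMeasure p with hμ
  have hint : ∀ (i : Fin n) (j : ℕ), ∫ y : Fin n → ℝ, y i ^ j ∂μ = ∫ u, u ^ j ∂genMeasure p :=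
    fun i j => integral_comp_eval (i := i) (f := fun u => u ^ j)
      (integrable_pow_genMeasure hp j).aestronglyMeasurable
  have hint' : ∀ (i : Fin n) (j : ℕ), Integrable (fun y : Fin n → ℝ => y i ^ j) μ := fun i j =>
    (measurePreserving_eval (fun _ : Fin n => genMeasure p) i).integrable_comp_of_integrable
      (integrable_pow_genMeasure hp j)
  have hv := le_second_moment hp
  have hvC : ∫ u, u ^ 2 ∂genMeasure p ≤ C := by
    have h := integral_mono (integrable_pow_genMeasure hp 2)
      (((integrable_const (1 : ℝ)).add (integrable_pow_genMeasure hp 4)).div_const 2)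
      (fun u => show u ^ 2 ≤ (1 + u ^ 4) / 2 by nlinarith [sq_nonneg (u ^ 2 - 1)])
    have h' : ∫ u, (1 + u ^ 4) / 2 ∂genMeasure p = (1 + ∫ u, u ^ 4 ∂genMeasure p) / 2 := by
      rw [integral_div, integral_add (integrable_const _) (integrable_pow_genMeasure hp 4)]
      simp
    have := hC p hp
    change _ ≤ ∫ u, (1 + u ^ 4) / 2 ∂genMeasure p at h
    linarith
  obtain ⟨hWi, -, hW2, hW4⟩ := moments_sum_mul (iIndepFun_coord hp0 n)
    (fun i => measurable_pi_apply i) hint'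
    (fun i => by
      have := hint i 1
      simp only [pow_one] at this
      rw [this]
      simpa using integral_odd_pow_genMeasure hp0 (j := 1) odd_one) hC1 hvC
    (fun i => hint i 2) (fun i => (hint i 4).trans_le (hC p hp)) x B
  have hWm : Measurable fun y : Fin n → ℝ => ∑ i ∈ B, x i * y i := by fun_prop
  set S := ∑ i ∈ B, x i ^ 2 with hS
  have hS0 : 0 ≤ S := Finset.sum_nonneg fun i _ => sq_nonneg _
  have htail := measureReal_sum_abs_rpow_tail (show 1 ≤ p by linarith) B
    (show 0 < 16 * L by linarith)
  rw [← hμ] at htail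
  have hW : 1 / (8 * L) ≤ μ.real {y | 1 / 12 * √S ≤ ∑ i ∈ B, x i * y i} := by
    rcases hS0.eq_or_lt with h0 | h0
    -- Paley–Zygmund needs a positive mean; if `x` vanishes on `B`, the event is everything.
    · have hx : ∀ i ∈ B, x i = 0 := fun i hi => by
        have := (Finset.sum_eq_zero_iff_of_nonneg fun i _ => sq_nonneg (x i)).1 h0.symm i hi
        simpa using this
      have huniv : {y : Fin n → ℝ | 1 / 12 * √S ≤ ∑ i ∈ B, x i * y i} = univ := by
        ext y
        simp only [mem_ofPred_eq, mem_univ, iff_true]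
        rw [← h0, Finset.sum_eq_zero fun i hi => by rw [hx i hi, zero_mul]]
        simp
      rw [huniv, probReal_univ, div_le_one (by linarith)]
      linarith
    · have hZ2 : Integrable (fun y : Fin n → ℝ => ((∑ i ∈ B, x i * y i) ^ 2) ^ 2) μ := by
        simpa only [← pow_mul] using hWi 4
      have hPZ := le_measureReal_half_mean_le (hWm.pow_const 2) (hWi 2) hZ2
        (m := S / 64) (L := L) (by positivity) (by linarith) (by rw [hW2]; nlinarith) (by
          simp only [← pow_mul]
          refine hW4.trans (le_of_eq ?_)
          rw [hL]
          ring)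
      have hsub : {y : Fin n → ℝ | S / 64 / 2 ≤ (∑ i ∈ B, x i * y i) ^ 2} ⊆
          {y | 1 / 12 * √S ≤ ∑ i ∈ B, x i * y i} ∪ {y | 1 / 12 * √S ≤ -∑ i ∈ B, x i * y i} := by
        intro y hy
        simp only [mem_ofPred_eq, mem_union] at hy ⊢
        rw [← le_abs]
        refine abs_le_of_sq_le_sq' ?_ (abs_nonneg _) |>.2
        rw [sq_abs, mul_pow, Real.sq_sqrt hS0]
        linarith
      have h1 := (measureReal_mono (μ := μ) hsub).trans (measureReal_union_le _ _)
      rw [measureReal_le_sum_eq_le_neg_sum hp0] at h1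
      have h2 : 1 / (8 * L) = 1 / (4 * L) / 2 := by
        field_simp
        norm_num
      linarith
  have hsub : {y : Fin n → ℝ | 1 / 12 * √S ≤ ∑ i ∈ B, x i * y i} ⊆
      {y | 1 / 12 * √S ≤ ∑ i ∈ B, x i * y i ∧ ∑ i ∈ B, |y i| ^ p ≤ 16 * L * B.card} ∪
        {y | 16 * L * B.card < ∑ i ∈ B, |y i| ^ p} := fun y hy => by
    rcases le_or_gt (∑ i ∈ B, |y i| ^ p) (16 * L * B.card) with h | h
    · exact Or.inl ⟨hy, h⟩
    · exact Or.inr h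
  have h1 := (measureReal_mono (μ := μ) hsub).trans (measureReal_union_le _ _)
  rw [Real.exp_neg, Real.exp_log (by linarith), blockProb]
  have h2 : 1 / (8 * L) = (16 * L)⁻¹ + 1 / (16 * L) := by
    field_simp
    norm_num
  linarith

/-! ### The tail of the inner product -/

theorem exists_subset_sum_mem_Icc {ι : Type*} [DecidableEq ι] {w : ι → ℝ} {δ : ℝ}
    (s : Finset ι) (hw : ∀ i ∈ s, w i ≤ δ) (hs : δ ≤ ∑ i ∈ s, w i) (hδ : 0 < δ) :
    ∃ T ⊆ s, δ ≤ ∑ i ∈ T, w i ∧ ∑ i ∈ T, w i ≤ 2 * δ := by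
  induction s using Finset.induction_on with
  | empty => simp at hs; linarith
  | insert a s ha ih =>
    by_cases h : δ ≤ ∑ i ∈ s, w i
    · obtain ⟨T, hT, h1⟩ := ih (fun i hi => hw i (Finset.mem_insert_of_mem hi)) h
      exact ⟨T, hT.trans (Finset.subset_insert _ _), h1⟩
    · refine ⟨_, Finset.Subset.refl _, hs, ?_⟩
      push Not at h
      have := hw a (Finset.mem_insert_self _ _)
      rw [Finset.sum_insert ha]
      linarith

/-- Greedy splitting: if every weight is at most `δ` and the total is at least `2kδ`, then `k`
disjoint blocks of weight at least `δ` can be found. -/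
theorem exists_disjoint_blocks {ι : Type*} [DecidableEq ι] {w : ι → ℝ} {δ : ℝ} (hδ : 0 < δ)
    (k : ℕ) (s : Finset ι) (hw : ∀ i ∈ s, w i ≤ δ) (hs : 2 * k * δ ≤ ∑ i ∈ s, w i) :
    ∃ B : ℕ → Finset ι, (∀ j < k, B j ⊆ s ∧ δ ≤ ∑ i ∈ B j, w i) ∧
      ∀ i < k, ∀ j < k, i ≠ j → Disjoint (B i) (B j) := by
  induction k generalizing s with
  | zero => exact ⟨fun _ => ∅, by simp, by simp⟩
  | succ k ih =>
    push_cast at hs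
    have hk : (0 : ℝ) ≤ k * δ := by positivity
    obtain ⟨T, hT, h1, h2⟩ := exists_subset_sum_mem_Icc s hw (by linarith) hδ
    have h3 := Finset.sum_sdiff (f := w) hT
    obtain ⟨B, hB1, hB2⟩ := ih (s \ T) (fun i hi => hw i (Finset.sdiff_subset hi)) (by linarith)
    have hTB : ∀ j < k, Disjoint T (B j) := fun j hj =>
      Finset.disjoint_sdiff.mono_right (hB1 j hj).1
    refine ⟨fun j => if j = k then T else B j, fun j hj => ?_, fun i hi j hj hij => ?_⟩
    · by_cases h : j = k
      · simpa only [h, if_true] using ⟨hT, h1⟩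
      · simp only [h, if_false]
        have := hB1 j (by omega)
        exact ⟨this.1.trans Finset.sdiff_subset, this.2⟩
    · by_cases h : i = k <;> by_cases h' : j = k <;> simp only [h, h', if_true, if_false]
      · omega
      · exact hTB j (by omega)
      · exact (hTB i (by omega)).symm
      · exact hB2 i (by omega) j (by omega) hij

/-- Comparison of the `ℓ_q` and `ℓ_2` norms on a set of coordinates. -/
theorem rpow_le_sum_sq {p q : ℝ} (hp : 2 < p) (hpq : p.HolderConjugate q) {n : ℕ} (hn : 1 ≤ n)
    (x : Fin n → ℝ) (R : Finset (Fin n)) (hR : 1 / 2 ≤ ∑ i ∈ R, |x i| ^ q) :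
    ((n : ℝ) ^ (1 / p - 1 / 2)) ^ 2 / 4 ≤ ∑ i ∈ R, x i ^ 2 := by
  have hq : 0 < q := hpq.symm.pos
  have hp0 : 0 < p := hpq.pos
  have hn0 : (0 : ℝ) < n := by exact_mod_cast hn
  have hr : 2 / q = 2 - 2 / p := by
    have := hpq.inv_add_inv_eq_one
    field_simp at this ⊢
    linarith
  have hp1 : 2 / p ≤ 1 := by
    rw [div_le_one hp0]
    exact hp.le
  have hp2 : 0 ≤ 2 / p := by positivity
  have h := Real.rpow_sum_le_const_mul_sum_rpow_of_nonneg (s := R) (f := fun i => |x i| ^ q)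
    (p := 2 / q) (by linarith) fun i _ => by positivity
  have h1 : ∀ i, (|x i| ^ q) ^ (2 / q) = x i ^ 2 := fun i => by
    rw [← Real.rpow_mul (abs_nonneg _), mul_div_cancel₀ _ hq.ne', Real.rpow_two, sq_abs]
  simp only [h1] at h
  have hcard : (R.card : ℝ) ≤ n := by
    exact_mod_cast (Finset.card_le_univ R).trans_eq (Fintype.card_fin n)
  have h2 : (R.card : ℝ) ^ (2 / q - 1) ≤ (n : ℝ) ^ (2 / q - 1) :=
    Real.rpow_le_rpow (by positivity) hcard (by linarith)
  have h3 : (1 / 4 : ℝ) ≤ (∑ i ∈ R, |x i| ^ q) ^ (2 / q) := by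
    calc (1 / 4 : ℝ) = (1 / 2) ^ (2 : ℝ) := by norm_num
      _ ≤ (1 / 2) ^ (2 / q) :=
        Real.rpow_le_rpow_of_exponent_ge (by norm_num) (by norm_num) (by linarith)
      _ ≤ _ := Real.rpow_le_rpow (by norm_num) hR (by positivity)
  have hS : 0 ≤ ∑ i ∈ R, x i ^ 2 := Finset.sum_nonneg fun i _ => sq_nonneg _
  have h4 : (1 / 4 : ℝ) ≤ (n : ℝ) ^ (2 / q - 1) * ∑ i ∈ R, x i ^ 2 :=
    (h3.trans h).trans (by gcongr)
  have h5 : ((n : ℝ) ^ (1 / p - 1 / 2)) ^ 2 * (n : ℝ) ^ (2 / q - 1) = 1 := by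
    rw [← Real.rpow_natCast, ← Real.rpow_mul hn0.le, ← Real.rpow_add hn0, hr]
    convert Real.rpow_zero (n : ℝ) using 2
    push_cast
    ring
  set a2 := ((n : ℝ) ^ (1 / p - 1 / 2)) ^ 2
  have ha : 0 ≤ a2 := by positivity
  calc a2 / 4 = a2 * (1 / 4) := by ring
    _ ≤ a2 * ((n : ℝ) ^ (2 / q - 1) * ∑ i ∈ R, x i ^ 2) := by gcongr
    _ = (a2 * (n : ℝ) ^ (2 / q - 1)) * ∑ i ∈ R, x i ^ 2 := by ring
    _ = _ := by rw [h5, one_mul]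

/-- Few coordinates: each `i ∈ T` is pushed to the level `θ i / 2`, and the others are controlled
as one block. -/
theorem exp_le_blockProb_univ_of_levels {p c K A : ℝ} (hp : 2 ≤ p) {n : ℕ} {x : Fin n → ℝ}
    (hc : 0 < c) (hK : 1 ≤ K) (hA : 4 ≤ A)
    (hblock : ∀ B : Finset (Fin n),
      Real.exp (-A) ≤ blockProb p x B (c * √(∑ i ∈ B, x i ^ 2)) (K * B.card))
    {k : ℕ} (hkn : k ≤ n) {T : Finset (Fin n)} (hT : T.card ≤ k) {θ : Fin n → ℝ}
    (hθ : ∀ i, 0 ≤ θ i) (hθk : ∑ i ∈ T, θ i ^ p ≤ k) :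
    Real.exp (-(A * (k + 1))) ≤
      blockProb p x Finset.univ (∑ i ∈ T, |x i| * (θ i / 2)) ((K + 2) * n) := by
  have hp0 : 0 < p := by linarith
  have hTk : (T.card : ℝ) ≤ k := by exact_mod_cast hT
  have hkn' : (k : ℝ) ≤ n := by exact_mod_cast hkn
  have h1 := prod_blockProb_le_biUnion hp0 x T (fun i => {i}) (fun i => |x i| * (θ i / 2))
    (fun i => 1 + θ i ^ p) fun i _ j _ hij => by simpa using hij
  have h2 : Real.exp (-(4 * k)) ≤ ∏ i ∈ T, blockProb p x {i} (|x i| * (θ i / 2)) (1 + θ i ^ p) :=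
    calc Real.exp (-(4 * k)) ≤ Real.exp (∑ i ∈ T, (-3 - θ i ^ p)) := by
          rw [Finset.sum_sub_distrib, Finset.sum_const, nsmul_eq_mul]
          gcongr
          linarith
      _ = ∏ i ∈ T, Real.exp (-3 - θ i ^ p) := Real.exp_sum _ _
      _ ≤ _ := Finset.prod_le_prod (fun i _ => (Real.exp_pos _).le)
          fun i _ => exp_le_blockProb_singleton (by linarith) x i (hθ i)
  rw [Finset.biUnion_singleton_eq_self] at h1
  have h3 := blockProb_mul_le_union hp0 x (disjoint_compl_right (a := T))
    (∑ i ∈ T, |x i| * (θ i / 2)) (c * √(∑ i ∈ Tᶜ, x i ^ 2)) (∑ i ∈ T, (1 + θ i ^ p))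
    (K * (Tᶜ).card)
  rw [Finset.union_compl] at h3
  have hcc : ((Tᶜ).card : ℝ) ≤ n := by
    exact_mod_cast (Finset.card_le_univ Tᶜ).trans_eq (Fintype.card_fin n)
  calc Real.exp (-(A * (k + 1))) ≤ Real.exp (-(4 * k)) * Real.exp (-A) := by
        rw [← Real.exp_add]
        gcongr
        have : (0 : ℝ) ≤ k := by positivity
        nlinarith
    _ ≤ _ := mul_le_mul (h2.trans h1) (hblock _) (Real.exp_pos _).le measureReal_nonneg
    _ ≤ _ := h3
    _ ≤ _ := blockProb_mono hp0 x _ (by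
        have : 0 ≤ c * √(∑ i ∈ Tᶜ, x i ^ 2) := by positivity
        linarith) (by
        rw [Finset.sum_add_distrib, Finset.sum_const, nsmul_eq_mul, mul_one]
        have : K * ((Tᶜ).card : ℝ) ≤ K * n := by gcongr
        linarith)

/-- Spread coordinates: `k` disjoint blocks each exceed a multiple of their standard deviation. -/
theorem exp_le_blockProb_univ_of_blocks {p c K A δ : ℝ} (hp : 0 < p) {n : ℕ} {x : Fin n → ℝ}
    (hc : 0 < c)
    (hblock : ∀ B : Finset (Fin n),
      Real.exp (-A) ≤ blockProb p x B (c * √(∑ i ∈ B, x i ^ 2)) (K * B.card))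
    {k : ℕ} {B : ℕ → Finset (Fin n)} (hB : ∀ j < k, δ ≤ ∑ i ∈ B j, x i ^ 2)
    (hdisj : ∀ i < k, ∀ j < k, i ≠ j → Disjoint (B i) (B j)) :
    Real.exp (-(A * (k + 1))) ≤ blockProb p x Finset.univ (k * (c * √δ)) (K * n) := by
  have hdisj' : ∀ i ∈ Finset.range k, ∀ j ∈ Finset.range k, i ≠ j → Disjoint (B i) (B j) :=
    fun i hi j hj => hdisj i (Finset.mem_range.1 hi) j (Finset.mem_range.1 hj)
  have h1 := prod_blockProb_le_biUnion hp x (Finset.range k) B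
    (fun j => c * √(∑ i ∈ B j, x i ^ 2)) (fun j => K * (B j).card) hdisj'
  have h2 : Real.exp (-A) ^ k ≤ ∏ j ∈ Finset.range k,
      blockProb p x (B j) (c * √(∑ i ∈ B j, x i ^ 2)) (K * (B j).card) := by
    have h := Finset.prod_le_prod (s := Finset.range k) (f := fun _ => Real.exp (-A))
      (fun _ _ => (Real.exp_pos _).le) fun j _ => hblock (B j)
    simpa using h
  set U := (Finset.range k).biUnion B with hU
  have h3 := blockProb_mul_le_union hp x (disjoint_compl_right (a := U))
    (∑ j ∈ Finset.range k, c * √(∑ i ∈ B j, x i ^ 2)) (c * √(∑ i ∈ Uᶜ, x i ^ 2))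
    (∑ j ∈ Finset.range k, K * (B j).card) (K * (Uᶜ).card)
  rw [Finset.union_compl] at h3
  have hcard : ∑ j ∈ Finset.range k, K * ((B j).card : ℝ) = K * U.card := by
    rw [hU, Finset.card_biUnion hdisj', ← Finset.mul_sum]
    push_cast
    rfl
  have hcompl : (U.card : ℝ) + (Uᶜ).card = n := by
    exact_mod_cast (Finset.card_add_card_compl U).trans (Fintype.card_fin n)
  calc Real.exp (-(A * (k + 1))) = Real.exp (-A) ^ k * Real.exp (-A) := by
        rw [← pow_succ, ← Real.exp_nat_mul]
        push_cast
        ring_nf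
    _ ≤ _ := mul_le_mul (h2.trans h1) (hblock _) (Real.exp_pos _).le measureReal_nonneg
    _ ≤ _ := h3
    _ ≤ _ := blockProb_mono hp x _ (by
        have h4 : 0 ≤ c * √(∑ i ∈ Uᶜ, x i ^ 2) := by positivity
        have h5 : ∑ j ∈ Finset.range k, c * √δ
            ≤ ∑ j ∈ Finset.range k, c * √(∑ i ∈ B j, x i ^ 2) :=
          Finset.sum_le_sum fun j hj => by
            have := hB j (Finset.mem_range.1 hj)
            gcongr
        rw [Finset.sum_const, Finset.card_range, nsmul_eq_mul] at h5
        linarith) (by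
        rw [hcard, ← mul_add, hcompl])

/-- The lower bound for the tail of the inner product at the level `√k` standard deviations,
jointly with the upper bound for the norm. -/
theorem exists_exp_le_blockProb_univ :
    ∃ c M A : ℝ, 0 < c ∧ 1 ≤ M ∧ 4 ≤ A ∧ ∀ (p q : ℝ), 2 < p → p.HolderConjugate q →
      ∀ (n k : ℕ), 1 ≤ k → k ≤ n → ∀ x : Fin n → ℝ, ∑ i, |x i| ^ q = 1 →
      Real.exp (-(A * (k + 1))) ≤
        blockProb p x Finset.univ (c * (√k * (n : ℝ) ^ (1 / p - 1 / 2))) (M * n) := by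
  obtain ⟨c, K, A, hc, hK, hA, hblock⟩ := exists_exp_le_blockProb
  refine ⟨min (1 / 6) (c / 3), K + 2, A, by positivity, by linarith, hA, ?_⟩
  intro p q hp hpq n k hk hkn x hx
  have hp0 : 0 < p := by linarith
  have hb := hblock p hp.le n x
  have hk0 : (0 : ℝ) < k := by exact_mod_cast hk
  have hn0 : (0 : ℝ) < n := by exact_mod_cast hk.trans hkn
  have hkn' : (k : ℝ) ≤ n := by exact_mod_cast hkn
  set a := (n : ℝ) ^ (1 / p - 1 / 2) with ha
  have ha0 : 0 < a := Real.rpow_pos_of_pos hn0 _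
  set δ := a ^ 2 / (8 * k) with hδ
  have hδ0 : 0 < δ := by positivity
  have hska : 0 ≤ √k * a := by positivity
  have hkδ : √k * a / 3 ≤ k * √δ := by
    refine abs_le_of_sq_le_sq' ?_ (by positivity) |>.2
    rw [div_pow, mul_pow, mul_pow, Real.sq_sqrt hk0.le, Real.sq_sqrt hδ0.le, hδ]
    have : (k : ℝ) ^ 2 * (a ^ 2 / (8 * k)) = k * a ^ 2 / 8 := by field_simp
    rw [this]
    have : 0 ≤ k * a ^ 2 := by positivity
    linarith
  have hmin1 : min (1 / 6) (c / 3) * (√k * a) ≤ 1 / 6 * (√k * a) := by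
    gcongr
    exact min_le_left _ _
  have hmin2 : min (1 / 6) (c / 3) * (√k * a) ≤ c / 3 * (√k * a) := by
    gcongr
    exact min_le_right _ _
  classical
  set T := Finset.univ.filter fun i => δ < x i ^ 2 with hT
  rcases le_or_gt k T.card with hcard | hcard
  -- Many large coordinates: `k` of them at a constant level suffice.
  · obtain ⟨T', hT', hT'k⟩ := Finset.exists_subset_card_eq hcard
    refine (exp_le_blockProb_univ_of_levels hp.le hc hK hA hb hkn hT'k.le (θ := fun _ => 1)
      (fun _ => zero_le_one) (by simp [hT'k])).trans (blockProb_mono hp0 x _ ?_ le_rfl)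
    have h1 : ∑ i ∈ T', √δ * (1 / 2) ≤ ∑ i ∈ T', |x i| * (1 / 2) :=
      Finset.sum_le_sum fun i hi => by
        have := (Finset.mem_filter.1 (hT' hi)).2
        gcongr
        exact Real.sqrt_le_iff.2 ⟨abs_nonneg _, by rw [sq_abs]; exact this.le⟩
    rw [Finset.sum_const, hT'k, nsmul_eq_mul] at h1
    linarith
  rcases le_or_gt (1 / 2) (∑ i ∈ T, |x i| ^ q) with hTq | hTq
  -- Few large coordinates carrying the norm: the levels are those of equality in Hölder.
  · have hθp : ∀ i, (((k : ℝ) * |x i| ^ q) ^ (1 / p)) ^ p = k * |x i| ^ q := fun i => by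
      rw [← Real.rpow_mul (by positivity), one_div_mul_cancel hp0.ne', Real.rpow_one]
    have hT1 : ∑ i ∈ T, |x i| ^ q ≤ 1 := by
      rw [← hx]
      exact Finset.sum_le_sum_of_subset_of_nonneg (Finset.subset_univ _)
        fun i _ _ => by positivity
    refine (exp_le_blockProb_univ_of_levels hp.le hc hK hA hb hkn hcard.le
      (θ := fun i => ((k : ℝ) * |x i| ^ q) ^ (1 / p)) (fun i => by positivity) ?_).trans
      (blockProb_mono hp0 x _ ?_ le_rfl)
    · simp only [hθp, ← Finset.mul_sum]
      nlinarith
    · have hterm : ∀ i, |x i| * (((k : ℝ) * |x i| ^ q) ^ (1 / p) / 2)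
          = (k : ℝ) ^ (1 / p) / 2 * |x i| ^ q := fun i => by
        rw [Real.mul_rpow (by positivity) (by positivity), ← Real.rpow_mul (abs_nonneg _)]
        have he : |x i| * |x i| ^ (q * (1 / p)) = |x i| ^ q := by
          have : q = 1 + q * (1 / p) := by
            have := hpq.inv_add_inv_eq_one
            have := hpq.symm.pos
            field_simp at *
            linarith
          conv_rhs => rw [this, Real.rpow_add' (abs_nonneg _) (by
            have := hpq.symm.pos
            positivity), Real.rpow_one]
        linear_combination (k : ℝ) ^ (1 / p) / 2 * he
      simp only [hterm, ← Finset.mul_sum]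
      have hka : √k * a ≤ (k : ℝ) ^ (1 / p) := by
        have h1 : a ≤ (k : ℝ) ^ (1 / p - 1 / 2) := by
          refine Real.rpow_le_rpow_of_nonpos hk0 hkn' ?_
          have : 1 / p ≤ 1 / 2 := by gcongr
          linarith
        calc √k * a ≤ √k * (k : ℝ) ^ (1 / p - 1 / 2) := by gcongr
          _ = (k : ℝ) ^ (1 / p) := by
            rw [Real.sqrt_eq_rpow, ← Real.rpow_add hk0]
            ring_nf
      have h2 : (k : ℝ) ^ (1 / p) / 2 * (1 / 2) ≤
          (k : ℝ) ^ (1 / p) / 2 * ∑ i ∈ T, |x i| ^ q := by gcongr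
      linarith
  -- The small coordinates carry the norm: they split into `k` blocks of comparable variance.
  · have hR : 1 / 2 ≤ ∑ i ∈ Tᶜ, |x i| ^ q := by
      have := Finset.sum_add_sum_compl T fun i => |x i| ^ q
      linarith
    have hR2 := rpow_le_sum_sq hp hpq (hk.trans hkn) x _ hR
    rw [← ha] at hR2
    obtain ⟨B, hB1, hB2⟩ := exists_disjoint_blocks (w := fun i => x i ^ 2) hδ0 k Tᶜ
      (fun i hi => by simpa [hT] using hi) (by
        refine le_trans (le_of_eq ?_) hR2
        rw [hδ]
        field_simp
        norm_num)
    refine (exp_le_blockProb_univ_of_blocks hp0 hc hb (fun j hj => (hB1 j hj).2) hB2).trans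
      (blockProb_mono hp0 x _ ?_ (by nlinarith))
    nlinarith

/-! ### Caps, nets and the union bound -/

theorem measurable_lpNorm {p : ℝ} (hp : 0 < p) (n : ℕ) :
    Measurable fun y : Fin n → ℝ => lpNorm (ENNReal.ofReal p) y := by
  simp_rw [lpNorm_ofReal hp]
  fun_prop

theorem measurable_normalize {p : ℝ} (hp : 0 < p) (n : ℕ) :
    Measurable fun y : Fin n → ℝ => (lpNorm (ENNReal.ofReal p) y)⁻¹ • y :=
  (measurable_lpNorm hp n).inv.smul measurable_id

theorem measurableSet_cap {n : ℕ} (x : Fin n → ℝ) (t : ℝ) :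
    MeasurableSet {v : Fin n → ℝ | t ≤ x ⬝ᵥ v} := by
  unfold dotProduct
  exact measurableSet_le measurable_const (by fun_prop)

theorem sum_abs_rpow_eq_one {q : ℝ} (hq : 0 < q) {n : ℕ} {x : Fin n → ℝ}
    (hx : x ∈ lpSphere (ENNReal.ofReal q) n) : ∑ i, |x i| ^ q = 1 := by
  have h : (∑ i, |x i| ^ q) ^ (1 / q) = 1 := by
    rw [← lpNorm_ofReal hq]
    exact hx
  have h0 : 0 ≤ ∑ i, |x i| ^ q := Finset.sum_nonneg fun i _ => by positivity
  calc ∑ i, |x i| ^ q = ((∑ i, |x i| ^ q) ^ (1 / q)) ^ q := by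
        rw [← Real.rpow_mul h0, one_div_mul_cancel hq.ne', Real.rpow_one]
    _ = 1 := by rw [h, Real.one_rpow]

theorem abs_le_one_of_mem_lpSphere {q : ℝ} (hq : 0 < q) {n : ℕ} {x : Fin n → ℝ}
    (hx : x ∈ lpSphere (ENNReal.ofReal q) n) (i : Fin n) : |x i| ≤ 1 := by
  by_contra! h
  have h1 := Real.one_lt_rpow h hq
  have h2 := Finset.single_le_sum (f := fun i => |x i| ^ q) (fun i _ => by positivity)
    (Finset.mem_univ i)
  rw [sum_abs_rpow_eq_one hq hx] at h2
  linarith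

theorem evenMeasure_compl_lpSphere {p : ℝ} (hp : 1 ≤ p) {n : ℕ} (hn : 1 ≤ n) :
    evenMeasure p n (lpSphere (ENNReal.ofReal p) n)ᶜ = 0 := by
  have hp0 : 0 < p := by linarith
  have := isProbabilityMeasure_genMeasure hp0
  have := nullSingletonClass_genMeasure p
  have : Fact (1 ≤ ENNReal.ofReal p) := ⟨by simpa using hp⟩
  have hS : MeasurableSet (lpSphere (ENNReal.ofReal p) n) :=
    measurableSet_eq_fun (measurable_lpNorm hp0 n) measurable_const
  rw [evenMeasure, Measure.map_apply (measurable_normalize hp0 n) hS.compl]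
  have hnull : (Measure.pi fun _ : Fin n => genMeasure p)
      ((fun y : Fin n → ℝ => y ⟨0, hn⟩) ⁻¹' {0}) = 0 := by
    rw [(measurePreserving_eval (fun _ : Fin n => genMeasure p) ⟨0, hn⟩).measure_preimage
      (measurableSet_singleton 0).nullMeasurableSet, measure_singleton]
  refine measure_mono_null (fun y hy => ?_) hnull
  by_contra hy0
  refine hy ?_
  have hne : ‖WithLp.toLp (ENNReal.ofReal p) y‖ ≠ 0 := by
    rw [norm_ne_zero_iff]
    intro h
    refine hy0 ?_
    have h' : y = 0 := by simpa using h
    simp [h']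
  change ‖WithLp.toLp (ENNReal.ofReal p) (‖WithLp.toLp (ENNReal.ofReal p) y‖⁻¹ • y)‖ = 1
  rw [WithLp.toLp_smul, norm_smul, norm_inv, norm_norm, inv_mul_cancel₀ hne]

/-- The caps of height `≈ √(log n / n)` have even measure at least polynomially small, with
exponent and constants independent of `p` and of the centre `x` of the cap. -/
theorem exists_le_evenMeasure_cap :
    ∃ c A : ℝ, 0 < c ∧ 0 < A ∧ ∀ (p q : ℝ), 2 < p → p.HolderConjugate q →
      ∀ n : ℕ, 2 ≤ n → ∀ x ∈ lpSphere (ENNReal.ofReal q) n,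
      Real.exp (-(2 * A)) * (n : ℝ) ^ (-A) ≤
        (evenMeasure p n).real {v | c * √(Real.log n / n) ≤ x ⬝ᵥ v} := by
  obtain ⟨c, M, A, hc, hM, hA, h⟩ := exists_exp_le_blockProb_univ
  refine ⟨c / M, A, by positivity, by linarith, fun p q hp hpq n hn x hx => ?_⟩
  have hp0 : 0 < p := by linarith
  have := isProbabilityMeasure_genMeasure hp0
  have hn0 : (0 : ℝ) < n := by positivity
  have hlog : 0 < Real.log n := Real.log_pos (by exact_mod_cast hn)
  set k := ⌈Real.log n⌉₊ with hk
  have hk1 : 1 ≤ k := Nat.one_le_iff_ne_zero.2 (Nat.ceil_pos.2 hlog).ne'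
  have hkn : k ≤ n := Nat.ceil_le.2 ((Real.log_le_sub_one_of_pos hn0).trans (by linarith))
  have hklog : Real.log n ≤ k := Nat.le_ceil _
  have hklog' : (k : ℝ) < Real.log n + 1 := Nat.ceil_lt_add_one hlog.le
  have hk0 : (0 : ℝ) < k := by exact_mod_cast hk1
  have hb := h p q hp hpq n k hk1 hkn x (sum_abs_rpow_eq_one hpq.symm.pos hx)
  have hcap := measurableSet_cap x (c / M * √(Real.log n / n))
  calc Real.exp (-(2 * A)) * (n : ℝ) ^ (-A) = Real.exp (-(A * (Real.log n + 2))) := by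
        rw [Real.rpow_def_of_pos hn0, ← Real.exp_add]
        ring_nf
    _ ≤ Real.exp (-(A * (k + 1))) := by
        rw [Real.exp_le_exp, neg_le_neg_iff]
        refine mul_le_mul_of_nonneg_left ?_ (by linarith)
        linarith
    _ ≤ _ := hb
    _ ≤ _ := by
        rw [blockProb, evenMeasure, map_measureReal_apply (measurable_normalize hp0 n) hcap]
        refine measureReal_mono fun y hy => ?_
        obtain ⟨hy1, hy2⟩ := hy
        simp only [mem_preimage, mem_ofPred_eq, dotProduct_smul, smul_eq_mul]
        have ha0 : 0 < (n : ℝ) ^ (1 / p - 1 / 2) := Real.rpow_pos_of_pos hn0 _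
        set W := ∑ i, x i * y i with hW
        have hWpos : 0 < W := lt_of_lt_of_le (by positivity) hy1
        have hS0 : 0 ≤ ∑ i, |y i| ^ p := Finset.sum_nonneg fun i _ => by positivity
        have hSpos : 0 < ∑ i, |y i| ^ p := by
          refine hS0.lt_of_ne fun h0 => hWpos.ne' ?_
          refine Finset.sum_eq_zero fun i hi => ?_
          have h1 := (Finset.sum_eq_zero_iff_of_nonneg fun i _ => by positivity).1 h0.symm i hi
          rw [Real.rpow_eq_zero (abs_nonneg _) hp0.ne', abs_eq_zero] at h1
          rw [h1, mul_zero]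
        have hNpos : 0 < lpNorm (ENNReal.ofReal p) y := by
          rw [lpNorm_ofReal hp0]
          positivity
        have hN : lpNorm (ENNReal.ofReal p) y ≤ M * (n : ℝ) ^ (1 / p) := by
          rw [lpNorm_ofReal hp0]
          calc (∑ i, |y i| ^ p) ^ (1 / p) ≤ (M * n) ^ (1 / p) := by gcongr
            _ = M ^ (1 / p) * (n : ℝ) ^ (1 / p) := Real.mul_rpow (by linarith) hn0.le
            _ ≤ M ^ (1 : ℝ) * (n : ℝ) ^ (1 / p) := by
              refine mul_le_mul_of_nonneg_right ?_ (by positivity)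
              refine Real.rpow_le_rpow_of_exponent_le hM ?_
              rw [div_le_one hp0]
              linarith
            _ = _ := by rw [Real.rpow_one]
        rw [show x ⬝ᵥ y = W from rfl, ← div_eq_inv_mul, le_div_iff₀ hNpos]
        calc c / M * √(Real.log n / n) * lpNorm (ENNReal.ofReal p) y
            ≤ c / M * √(k / n) * (M * (n : ℝ) ^ (1 / p)) := by gcongr
          _ = c * (√k * (n : ℝ) ^ (1 / p - 1 / 2)) := by
              rw [Real.sqrt_div hk0.le, Real.rpow_sub hn0, ← Real.sqrt_eq_rpow]
              field_simp
          _ ≤ W := hy1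

/-- Rounding the coordinates to multiples of `1 / m` gives a net, in the sup norm, of any subset
of the cube; its points are taken in the subset itself. -/
theorem exists_finset_net {n : ℕ} (S : Set (Fin n → ℝ)) (hS : ∀ x ∈ S, ∀ i, |x i| ≤ 1) {m : ℕ}
    (hm : 0 < m) :
    ∃ F : Finset (Fin n → ℝ), (∀ x ∈ F, x ∈ S) ∧ F.card ≤ (2 * m + 1) ^ n ∧
      ∀ x ∈ S, ∃ x' ∈ F, ∀ i, |x i - x' i| ≤ 1 / m := by
  classical
  have hm0 : (0 : ℝ) < m := by exact_mod_cast hm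
  let φ : (Fin n → ℝ) → Fin n → ℕ := fun x i => ⌊(m : ℝ) * (x i + 1)⌋₊
  let g : (Fin n → ℕ) → Fin n → ℝ := fun a => if h : ∃ x ∈ S, φ x = a then h.choose else 0
  have hg : ∀ a, (∃ x ∈ S, φ x = a) → g a ∈ S ∧ φ (g a) = a := fun a ha => by
    simp only [g, dif_pos ha]
    exact ha.choose_spec
  let I := (Fintype.piFinset fun _ : Fin n => Finset.range (2 * m + 1)).filter
    fun a => ∃ x ∈ S, φ x = a
  refine ⟨I.image g, fun x hx => ?_, ?_, fun x hx => ⟨g (φ x), ?_, fun i => ?_⟩⟩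
  · obtain ⟨a, ha, rfl⟩ := Finset.mem_image.1 hx
    exact (hg a (Finset.mem_filter.1 ha).2).1
  · refine Finset.card_image_le.trans ((Finset.card_filter_le _ _).trans ?_)
    simp
  · refine Finset.mem_image_of_mem _ (Finset.mem_filter.2 ⟨?_, x, hx, rfl⟩)
    refine Fintype.mem_piFinset.2 fun i => Finset.mem_range.2 (Nat.lt_succ_of_le ?_)
    refine Nat.floor_le_of_le ?_
    have := (abs_le.1 (hS x hx i)).2
    push_cast
    nlinarith
  · obtain ⟨h1, h2⟩ := hg (φ x) ⟨x, hx, rfl⟩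
    have h3 : ⌊(m : ℝ) * (g (φ x) i + 1)⌋₊ = ⌊(m : ℝ) * (x i + 1)⌋₊ := congrFun h2 i
    have e1 := (abs_le.1 (hS x hx i)).1
    have e2 := (abs_le.1 (hS _ h1 i)).1
    have a1 := Nat.floor_le (show 0 ≤ (m : ℝ) * (x i + 1) from mul_nonneg hm0.le (by linarith))
    have a2 := Nat.lt_floor_add_one ((m : ℝ) * (x i + 1))
    have a3 := Nat.floor_le
      (show 0 ≤ (m : ℝ) * (g (φ x) i + 1) from mul_nonneg hm0.le (by linarith))
    have a4 := Nat.lt_floor_add_one ((m : ℝ) * (g (φ x) i + 1))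
    rw [h3] at a3 a4
    have h4 : |(x i - g (φ x) i) * m| ≤ 1 := abs_le.2 ⟨by linarith, by linarith⟩
    rwa [le_div_iff₀ hm0, ← abs_of_pos hm0, ← abs_mul]

theorem dotProduct_le_add_of_close {n : ℕ} {x x' v : Fin n → ℝ} {r : ℝ}
    (hv : ∀ i, |v i| ≤ 1) (hx : ∀ i, |x i - x' i| ≤ r) : x' ⬝ᵥ v ≤ x ⬝ᵥ v + n * r := by
  have h : ∑ i, (x' i * v i - x i * v i) ≤ ∑ _i : Fin n, r := Finset.sum_le_sum fun i _ => by
    calc x' i * v i - x i * v i = -((x i - x' i) * v i) := by ring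
      _ ≤ |(x i - x' i) * v i| := neg_le_abs _
      _ = |x i - x' i| * |v i| := abs_mul _ _
      _ ≤ |x i - x' i| * 1 := by
        have := hv i
        gcongr
      _ ≤ r := by linarith [hx i]
  rw [Finset.sum_sub_distrib] at h
  simp only [Finset.sum_const, Finset.card_univ, Fintype.card_fin, nsmul_eq_mul] at h
  unfold dotProduct
  linarith

/-- If the caps of height `2 τ` around the points of a fine net all meet `H`, then `H` is a
`τ`-hitting set. The net is fine in the sup norm, and `n * r` is the resulting error. -/
theorem isHittingSet_of_net {p q τ r : ℝ} (hp : 0 < p) {n : ℕ} (hτ : 0 ≤ τ) (hr : n * r ≤ τ)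
    {F : Finset (Fin n → ℝ)}
    (hF : ∀ x ∈ lpSphere (ENNReal.ofReal q) n, ∃ x' ∈ F, ∀ i, |x i - x' i| ≤ r)
    {H : Set (Fin n → ℝ)} (hH : H ⊆ lpSphere (ENNReal.ofReal p) n)
    (hFH : ∀ x' ∈ F, ∃ v ∈ H, 2 * τ ≤ x' ⬝ᵥ v) :
    IsHittingSet (ENNReal.ofReal p) (ENNReal.ofReal q) τ H := by
  refine ⟨hH, hτ, Subset.antisymm (iUnion₂_subset fun v _ x hx => hx.1) fun x hx => ?_⟩
  obtain ⟨x', hx', hxx'⟩ := hF x hx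
  obtain ⟨v, hv, h⟩ := hFH x' hx'
  refine mem_iUnion₂.2 ⟨v, hv, hx, ?_⟩
  have := dotProduct_le_add_of_close (abs_le_one_of_mem_lpSphere hp (hH hv)) hxx'
  linarith

/-- The probability that `N` independent vectors all miss a set of probability at least `ρ`. -/
theorem measureReal_forall_notMem_le {Ω V : Type*} [MeasurableSpace Ω] [MeasurableSpace V]
    {P : Measure Ω} [IsProbabilityMeasure P] {ν : Measure V} [IsProbabilityMeasure ν] {N : ℕ}
    {z : Fin N → Ω → V} (hz : ∀ i, HasLaw (z i) ν P) (hind : iIndepFun z P) {E : Set V}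
    (hE : MeasurableSet E) {ρ : ℝ} (hρ : ρ ≤ ν.real E) :
    P.real {ω | ∀ i, z i ω ∉ E} ≤ Real.exp (-(ρ * N)) := by
  have h := hind.measure_inter_preimage_eq_mul Finset.univ (sets := fun _ => Eᶜ)
    fun _ _ => hE.compl
  have hset : {ω | ∀ i, z i ω ∉ E} = ⋂ i ∈ Finset.univ, z i ⁻¹' Eᶜ := by
    ext ω
    simp
  have hi : ∀ i, (P (z i ⁻¹' Eᶜ)).toReal ≤ Real.exp (-ρ) := fun i => by
    rw [← Measure.map_apply_of_aemeasurable (hz i).aemeasurable hE.compl, (hz i).map_eq,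
      ← measureReal_def, probReal_compl_eq_one_sub hE]
    have := Real.add_one_le_exp (-ρ)
    linarith
  rw [hset, measureReal_def, h, ENNReal.toReal_prod]
  calc ∏ i, (P (z i ⁻¹' Eᶜ)).toReal ≤ ∏ _i : Fin N, Real.exp (-ρ) :=
        Finset.prod_le_prod (fun i _ => ENNReal.toReal_nonneg) fun i _ => hi i
    _ = Real.exp (-(ρ * N)) := by
        rw [Finset.prod_const, Finset.card_univ, Fintype.card_fin, ← Real.exp_nat_mul]
        ring_nf

/-- The union bound over a net of `exp (O(n log n))` points. -/
theorem card_mul_exp_le {A q ε : ℝ} {n d : ℕ} (hq : 1 / 2 ≤ 1 / q) (hε : 0 < ε)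
    (hε1 : ε < 1) (hn : 2 ≤ n) {s : ℝ} (hs : s ≤ ((n : ℝ) ^ (d + 2)) ^ n) :
    s * Real.exp (-(Real.exp (-(2 * A)) * (n : ℝ) ^ (-A)
      * sampleSize A (Real.exp (2 * A) * (d + 2)) q ε n)) ≤ ε := by
  have hn0 : (0 : ℝ) < n := by positivity
  have hlog : 0 < Real.log n := Real.log_pos (by exact_mod_cast hn)
  have hlε : 0 < Real.log (1 / ε) := Real.log_pos (by rw [lt_div_iff₀ hε]; linarith)
  have hN : Real.exp (2 * A) * (d + 2) * (n : ℝ) ^ A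
      * ((1 / 2 + 1 / q) * n * Real.log n + Real.log (1 / ε))
      ≤ sampleSize A (Real.exp (2 * A) * (d + 2)) q ε n := Nat.le_ceil _
  have h1 : Real.exp (-(2 * A)) * (n : ℝ) ^ (-A) * (Real.exp (2 * A) * (d + 2) * (n : ℝ) ^ A
      * ((1 / 2 + 1 / q) * n * Real.log n + Real.log (1 / ε)))
      = (d + 2) * ((1 / 2 + 1 / q) * n * Real.log n + Real.log (1 / ε)) := by
    have e1 : Real.exp (-(2 * A)) * Real.exp (2 * A) = 1 := by
      rw [← Real.exp_add]
      simp
    have e2 : (n : ℝ) ^ (-A) * (n : ℝ) ^ A = 1 := by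
      rw [← Real.rpow_add hn0]
      simp
    linear_combination (((d + 2) * ((1 / 2 + 1 / q) * n * Real.log n + Real.log (1 / ε))) *
      ((n : ℝ) ^ (-A) * (n : ℝ) ^ A)) * e1
      + ((d + 2) * ((1 / 2 + 1 / q) * n * Real.log n + Real.log (1 / ε))) * e2
  have h2 : (d + 2) * (n * Real.log n) + Real.log (1 / ε)
      ≤ (d + 2) * ((1 / 2 + 1 / q) * n * Real.log n + Real.log (1 / ε)) := by
    have h3 : n * Real.log n ≤ (1 / 2 + 1 / q) * n * Real.log n := by
      have : 0 ≤ n * Real.log n := by positivity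
      nlinarith
    have hd : (0 : ℝ) ≤ d := by positivity
    nlinarith
  have h3 : (d + 2) * (n * Real.log n) + Real.log (1 / ε) ≤ Real.exp (-(2 * A)) * (n : ℝ) ^ (-A)
      * sampleSize A (Real.exp (2 * A) * (d + 2)) q ε n :=
    (h2.trans_eq h1.symm).trans (by gcongr)
  have h4 : ((n : ℝ) ^ (d + 2)) ^ n = Real.exp ((d + 2) * (n * Real.log n)) := by
    rw [← pow_mul, ← Real.exp_log (pow_pos hn0 _), Real.log_pow]
    push_cast
    ring_nf
  calc _ ≤ Real.exp ((d + 2) * (n * Real.log n))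
        * Real.exp (-((d + 2) * (n * Real.log n) + Real.log (1 / ε))) := by
        rw [← h4]
        gcongr
    _ = ε := by
        rw [← Real.exp_add, one_div, Real.log_inv]
        ring_nf
        exact Real.exp_log hε

end LpCovering

end

theorem mainTheorem7 :
    ∃ δ₀ δ₂ δ₃ : ℝ, 0 < δ₀ ∧ 0 < δ₂ ∧ 0 < δ₃ ∧
      ∀ (p q : ℝ), 2 < p → p.HolderConjugate q →
      ∀ (ε : ℝ), 0 < ε → ε < 1 →
      ∀ (n : ℕ), 2 ≤ n →
      ∀ (Ω : Type*) [MeasurableSpace Ω] (P : Measure Ω) [IsProbabilityMeasure P]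
        (z : Fin (LpCovering.sampleSize δ₂ δ₃ q ε n) → Ω → (Fin n → ℝ)),
        (∀ i, HasLaw (z i) (LpCovering.evenMeasure p n) P) →
        iIndepFun z P →
        ENNReal.ofReal (1 - ε) ≤
          P {ω | Set.range (fun i => z i ω) ∈
            LpCovering.hittingSets (ENNReal.ofReal p) (ENNReal.ofReal q) n
              (Real.sqrt (δ₀ * Real.log n / (2 * n))) (LpCovering.sampleSize δ₂ δ₃ q ε n)} := by
  obtain ⟨c, A, hc, hA, hcap⟩ := LpCovering.exists_le_evenMeasure_cap
  -- `D` makes the mesh `1 / (D n²)` of the net finer than the gap between the two heights.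
  obtain ⟨D, hD⟩ := exists_nat_gt (4 / c)
  have hD0 : (0 : ℝ) < D := lt_trans (by positivity) hD
  have hDpos : 0 < D := by exact_mod_cast hD0
  refine ⟨c ^ 2 / 2, A, Real.exp (2 * A) * ((3 * D : ℕ) + 2), by positivity, hA, by positivity, ?_⟩
  intro p q hp hpq ε hε hε1 n hn
  set N := LpCovering.sampleSize A (Real.exp (2 * A) * ((3 * D : ℕ) + 2)) q ε n
  intro Ω _ P _ z hz hind
  have hp0 : 0 < p := by linarith
  have hq0 : 0 < q := hpq.symm.pos
  have := LpCovering.isProbabilityMeasure_evenMeasure hp0 n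
  have hn0 : (0 : ℝ) < n := by positivity
  have hn2 : (2 : ℝ) ≤ n := by exact_mod_cast hn
  have hlog2 : 1 / 4 ≤ Real.log n := by
    have h1 := Real.log_two_gt_d9
    have h2 := Real.log_le_log two_pos hn2
    linarith
  have hq : 1 / 2 ≤ 1 / q := by
    have h1 := hpq.inv_add_inv_eq_one
    have h2 : p⁻¹ ≤ 2⁻¹ := by gcongr
    rw [one_div, one_div]
    linarith
  set τ := Real.sqrt (c ^ 2 / 2 * Real.log n / (2 * n)) with hτ
  have hτ2 : 2 * τ = c * √(Real.log n / n) := by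
    rw [hτ, show c ^ 2 / 2 * Real.log n / (2 * n) = (c / 2) ^ 2 * (Real.log n / n) by
      field_simp, Real.sqrt_mul (by positivity), Real.sqrt_sq (by positivity)]
    ring
  have hτ0 : 0 ≤ τ := Real.sqrt_nonneg _
  have hmesh : n * (1 / ((D * n ^ 2 : ℕ) : ℝ)) ≤ τ := by
    have h1 : 1 / (2 * n) ≤ √(Real.log n / n) := by
      refine Real.le_sqrt_of_sq_le ?_
      rw [div_pow, div_le_div_iff₀ (by positivity) hn0]
      nlinarith
    have h2 : n * (1 / ((D * n ^ 2 : ℕ) : ℝ)) = 1 / (D * n) := by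
      push_cast
      field_simp
    have h3 : 1 / (D * n) ≤ c / 2 * (1 / (2 * n)) := by
      rw [div_lt_iff₀ hc] at hD
      rw [div_mul_div_comm, div_le_div_iff₀ (by positivity) (by positivity)]
      nlinarith
    have h4 : c / 2 * (1 / (2 * n)) ≤ c / 2 * √(Real.log n / n) := by gcongr
    linarith
  obtain ⟨F, hFS, hFcard, hFnet⟩ := LpCovering.exists_finset_net
    (LpCovering.lpSphere (ENNReal.ofReal q) n)
    (fun x hx i => LpCovering.abs_le_one_of_mem_lpSphere hq0 hx i)
    (show 0 < D * n ^ 2 by positivity)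
  have hcard : (F.card : ℝ) ≤ ((n : ℝ) ^ (3 * D + 2)) ^ n := by
    have h1 : 2 * (D * n ^ 2) + 1 ≤ n ^ (3 * D + 2) := by
      have e1 : 3 * D ≤ n ^ (3 * D) :=
        (Nat.lt_two_pow_self (n := 3 * D)).le.trans (Nat.pow_le_pow_left hn _)
      have e2 : 1 ≤ D * n ^ 2 := Nat.one_le_iff_ne_zero.2 (by positivity)
      calc 2 * (D * n ^ 2) + 1 ≤ 3 * D * n ^ 2 := by linarith
        _ ≤ n ^ (3 * D) * n ^ 2 := Nat.mul_le_mul_right _ e1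
        _ = _ := (pow_add _ _ _).symm
    exact_mod_cast hFcard.trans (Nat.pow_le_pow_left h1 n)
  set good := {ω | Set.range (fun i => z i ω) ∈
    LpCovering.hittingSets (ENNReal.ofReal p) (ENNReal.ofReal q) n τ N} with hgood
  -- The samples lie on the sphere only almost surely, since `y / ‖y‖_p` is `0` at `y = 0`.
  let off := ⋃ i, z i ⁻¹' (LpCovering.lpSphere (ENNReal.ofReal p) n)ᶜ
  let miss : (Fin n → ℝ) → Set Ω := fun x => {ω | ∀ i, z i ω ∉ {v | 2 * τ ≤ x ⬝ᵥ v}}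
  have hoff : P.real off = 0 := by
    rw [measureReal_def, measure_iUnion_null fun i => ?_, ENNReal.toReal_zero]
    have hS : MeasurableSet (LpCovering.lpSphere (ENNReal.ofReal p) n) :=
      measurableSet_eq_fun (LpCovering.measurable_lpNorm hp0 n) measurable_const
    rw [← Measure.map_apply_of_aemeasurable (hz i).aemeasurable hS.compl, (hz i).map_eq]
    exact LpCovering.evenMeasure_compl_lpSphere (by linarith) (by omega)
  have hmiss : ∀ x ∈ F, P.real (miss x)
      ≤ Real.exp (-(Real.exp (-(2 * A)) * (n : ℝ) ^ (-A) * N)) := fun x hx => by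
    refine LpCovering.measureReal_forall_notMem_le hz hind
      (LpCovering.measurableSet_cap x _) ?_
    rw [hτ2]
    exact hcap p q hp hpq n hn x (hFS x hx)
  have hunion : P.real (⋃ x ∈ F, miss x) ≤ ε := by
    refine (measureReal_biUnion_finset_le F miss).trans ?_
    refine (Finset.sum_le_sum hmiss).trans ?_
    rw [Finset.sum_const, nsmul_eq_mul]
    exact LpCovering.card_mul_exp_le hq hε hε1 hn hcard
  -- The target event is not known to be measurable: its outer measure is bounded below through a
  -- cover of the whole space.
  have hcover : Set.univ ⊆ good ∪ (off ∪ ⋃ x ∈ F, miss x) := by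
    intro ω _
    by_contra hω
    simp only [Set.mem_union, not_or] at hω
    obtain ⟨h1, h2, h3⟩ := hω
    simp only [off, Set.mem_iUnion, Set.mem_preimage, Set.mem_compl_iff, not_exists,
      not_not] at h2
    simp only [miss, Set.mem_iUnion, Set.mem_ofPred_eq, not_exists, not_forall, not_not] at h3
    refine h1 ⟨LpCovering.isHittingSet_of_net hp0 hτ0 hmesh hFnet (Set.range_subset_iff.2 h2)
      fun x hx => ?_, ?_⟩
    · obtain ⟨i, hi⟩ := h3 x hx
      exact ⟨z i ω, ⟨i, rfl⟩, hi⟩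
    · rw [← Set.image_univ]
      refine (Set.encard_image_le _ _).trans ?_
      simp [Set.encard_univ]
  have htotal := (measureReal_mono (μ := P) hcover).trans (measureReal_union_le _ _)
  have hbad := measureReal_union_le (μ := P) off (⋃ x ∈ F, miss x)
  rw [probReal_univ] at htotal
  rw [ENNReal.ofReal_le_iff_le_toReal (measure_ne_top _ _), ← measureReal_def]
  linarith
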